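/- **Theorem 1.1.** Let $H$ and $E$ be separable real Hilbert spaces, let $V$ be a Hilbert space compactly embedded into $H$, and let $S:H\times E\to H$ be continuous. Let $\{\eta_k\}_{k\ge1}$ be i.i.d. random variables in $E$ whose law $\ell$ has compact support $\mathcal K\subset E$, and let $X\subset H$ be a compact set with $S(X\times\mathcal K)\subset X$. Consider the random dynamical system $$u_k=S(u_{k-1},\eta_k),\qquad k\ge1,$$ restricted to $X$. For $u\in H$ and $\zeta_1,\dots,\zeta_m\in E$ write $S_m(u;\zeta_1,\dots,\zeta_m)=u_m$, where $u_0=u$ and $u_k=S(u_{k-1},\zeta_k)$. Assume the following. * **(H1) Regularity.** $S$ is twice continuously differentiable from $H\times E$ to $V$, and its derivatives are bounded on bounded subsets. For every $u\in H$ the map $\eta\mapsto S(u,\eta)$ is analytic from $E$ to $H$, and all its derivatives $(D_\eta^jS)(u,\eta)$ are continuous functions of $(u,\eta)$ that are bounded on bounded subsets of $H\times E$. * **(H2) Approximate controllability to a point.** There is $\hat u\in X$ such that for every $\varepsilon>0$ there is an integer $m\ge1$ with the following property: for every $u\in X$ there are $\zeta_1,\dots,\zeta_m\in\mathcal K$ with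 $\|S_m(u;\zeta_1,\dots,\zeta_m)-\hat u\|<\varepsilon$. * **(H3) Approximate controllability of the linearisation.** For every $u\in X$, the image of the derivative $(D_\eta S)(u,\eta):E\to H$ is dense in $H$ for $\ell$-almost every $\eta\in E$. * **(H4) Structure of the noise.** There are a (finite or countable) orthonormal basis $\{e_j\}$ of $E$, independent scalar random variables $\xi_{jk}$, and nonzero real numbers $b_j$ with $\sum_jb_j^2<\infty$ such that $\eta_k=\sum_jb_j\xi_{jk}e_j$ almost surely for every $k\ge1$, and for all $j,k$ the law of $\xi_{jk}$ has a Lipschitz-continuous density $\rho_j$ with respect to the Lebesgue measure on $\mathbb R$. For $u\in X$ let $P_k(u,\cdot)$ be the law of $S_k(u;\eta_1,\dots,\eta_k)$. For a Borel probability measure $\lambda\in\mathcal P(X)$ put $(\mathfrak P_k^*\lambda)(\Gamma)=\int_XP_k(u,\Gamma)\,\lambda(du)$, and call $\mu\in\mathcal P(X)$ stationary if $\mathfrak P_1^*\mu=\mu$. Let $$\|\mu_1-\mu_2\|_L^*=\sup_{\|f\|_L\le1}\Bigl|\int_Xf\,d\mu_1-\int_Xf\,d\mu_2\Bigr|,\qquad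 \|f\|_L=\sup_X|f|+\sup_{0<\|u-v\|\le1}\frac{|f(u)-f(v)|}{\|u-v\|},$$ where $f$ ranges over the continuous functions $X\to\mathbb R$. Then there is a unique stationary measure $\mu\in\mathcal P(X)$, and there is a sequence of positive numbers $\gamma_k$ with $\gamma_k\to0$ as $k\to\infty$ such that $$\|\mathfrak P_k^*\lambda-\mu\|_L^*\le\gamma_k\qquad\text{for all }k\ge0\text{ and }\lambda\in\mathcal P(X).$$ -/

import Mathlib

open MeasureTheory ProbabilityTheory Filter Topology
open scoped ENNReal

namespace MixingRDS

/-! ### The dual-Lipschitz distance -/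

section DualLipschitz

variable {Y : Type*} [MetricSpace Y]

/-- The norm `‖f‖_L = sup |f| + sup_{0 < d(u,v) ≤ 1} |f u - f v| / d(u,v)`, with values in
`[0,∞]`. -/
noncomputable def lipNorm (f : Y → ℝ) : ℝ≥0∞ :=
  (⨆ u, ‖f u‖ₑ) +
    ⨆ (u : Y) (v : Y) (_ : 0 < dist u v ∧ dist u v ≤ 1), ‖f u - f v‖ₑ / edist u v

/-- The dual-Lipschitz distance `‖μ₁ - μ₂‖_L^* = sup_{‖f‖_L ≤ 1} |⟨f,μ₁⟩ - ⟨f,μ₂⟩|`, the supremum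
being taken over bounded continuous functions. -/
noncomputable def dualLip [MeasurableSpace Y] (μ₁ μ₂ : Measure Y) : ℝ≥0∞ :=
  ⨆ (f : BoundedContinuousFunction Y ℝ) (_ : lipNorm f ≤ 1),
    ‖(∫ u, f u ∂μ₁) - ∫ u, f u ∂μ₂‖ₑ

end DualLipschitz

/-! ### The random dynamical system and its Markov operators -/

/-- `traj S u ζ m` is `S_m(u; ζ 0, …, ζ (m-1))`: the state after `m` steps of
`u_{k+1} = S(u_k, ζ k)`, `u_0 = u`. The sequence of noises is numbered from `0`, so that `ζ k`
is the noise of the step from time `k` to time `k + 1`. -/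
def traj {H E : Type*} (S : H × E → H) (u : H) (ζ : ℕ → E) : ℕ → H
  | 0 => u
  | k + 1 => S (traj S u ζ k, ζ k)

section Markov

variable {H E Ω : Type*} [MeasurableSpace H] [MeasurableSpace Ω]

/-- The transition function `P_k(u, ·)` on the invariant set `X`: the law of the state at time `k`
of the trajectory issued from `u ∈ X`, as a measure on `X`. -/
noncomputable def transition (P : Measure Ω) (S : H × E → H) (η : ℕ → Ω → E) (X : Set H)
    (k : ℕ) (u : X) : Measure X :=
  (P.map fun ω => traj S (u : H) (fun i => η i ω) k).comap Subtype.val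

/-- The Markov operator `𝔓_k^* lam (Γ) = ∫_X P_k(u, Γ) lam(du)` on measures on `X`. -/
noncomputable def dualOp (P : Measure Ω) (S : H × E → H) (η : ℕ → Ω → E) (X : Set H)
    (k : ℕ) (lam : Measure X) : Measure X :=
  lam.bind (transition P S η X k)

/-- `μ` is a stationary measure: `𝔓_1^* μ = μ`. -/
def IsStationary (P : Measure Ω) (S : H × E → H) (η : ℕ → Ω → E) (X : Set H)
    (μ : ProbabilityMeasure X) : Prop :=
  dualOp P S η X 1 (μ : Measure X) = (μ : Measure X)

end Markov

/-! ### The hypotheses -/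

section Hypotheses

variable {H E V Ω : Type*}
  [NormedAddCommGroup H] [InnerProductSpace ℝ H]
  [NormedAddCommGroup E] [InnerProductSpace ℝ E]
  [NormedAddCommGroup V] [InnerProductSpace ℝ V]

/-- Regularity: `S` is twice continuously differentiable from `H × E` to `V` (embedded into `H`
by `emb`), with derivatives bounded on bounded sets; for each `u` the map `S(u, ·)` is analytic
from `E` to `H`, and all its derivatives are continuous in `(u, η)` and bounded on bounded sets. -/
def Regular (emb : V →L[ℝ] H) (S : H × E → H) : Prop :=
  (∃ T : H × E → V, (∀ x, S x = emb (T x)) ∧ ContDiff ℝ 2 T ∧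
    ∀ j : ℕ, 1 ≤ j → j ≤ 2 → ∀ B : Set (H × E), Bornology.IsBounded B →
      ∃ C : ℝ, ∀ x ∈ B, ‖iteratedFDeriv ℝ j T x‖ ≤ C) ∧
  (∀ u : H, AnalyticOnNhd ℝ (fun ζ : E => S (u, ζ)) Set.univ) ∧
  ∀ j : ℕ,
    (Continuous fun x : H × E => iteratedFDeriv ℝ j (fun ζ : E => S (x.1, ζ)) x.2) ∧
    ∀ B : Set (H × E), Bornology.IsBounded B →
      ∃ C : ℝ, ∀ x ∈ B, ‖iteratedFDeriv ℝ j (fun ζ : E => S (x.1, ζ)) x.2‖ ≤ C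

/-- Approximate controllability, by controls in `K`, from every point of `X` to one point of `X`,
in a time that depends only on the accuracy. -/
def ControllableToPoint (S : H × E → H) (X : Set H) (K : Set E) : Prop :=
  ∃ p ∈ X, ∀ ε : ℝ, 0 < ε → ∃ m : ℕ, 1 ≤ m ∧ ∀ u ∈ X,
    ∃ ζ : ℕ → E, (∀ i < m, ζ i ∈ K) ∧ ‖traj S u ζ m - p‖ < ε

/-- Approximate controllability of the linearisation: for every `u ∈ X`, the image of
`(D_η S)(u, η)` is dense in `H` for `ℓ`-almost every `η`. -/
def LinControllable [MeasurableSpace E] (S : H × E → H) (X : Set H) (ℓ : Measure E) : Prop :=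
  ∀ u ∈ X, ∀ᵐ η ∂ℓ, DenseRange (fderiv ℝ (fun ζ : E => S (u, ζ)) η)

/-- Structure of the noise: `η_k = ∑_j b_j ξ_{jk} e_j` for an orthonormal basis `e` of `E`
(indexed by a finite or countably infinite set), nonzero square-summable `b_j`, and independent
scalar random variables `ξ_{jk}` whose laws have Lipschitz-continuous densities `ρ_j`. -/
def Decomposable [MeasurableSpace Ω] (P : Measure Ω) (η : ℕ → Ω → E) : Prop :=
  ∃ (J : Type) (_ : Countable J) (e : HilbertBasis J ℝ E) (b : J → ℝ) (ξ : J → ℕ → Ω → ℝ)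
    (ρ : J → ℝ → ℝ),
    (∀ j, b j ≠ 0) ∧ (Summable fun j => b j ^ 2) ∧
    (∀ j k, Measurable (ξ j k)) ∧
    iIndepFun (fun i : J × ℕ => ξ i.1 i.2) P ∧
    (∀ k, ∀ᵐ ω ∂P, HasSum (fun j => (b j * ξ j k ω) • e j) (η k ω)) ∧
    ∀ j, (∀ x, 0 ≤ ρ j x) ∧ (∃ C, LipschitzWith C (ρ j)) ∧
      ∀ k, P.map (ξ j k) = volume.withDensity fun x => ENNReal.ofReal (ρ j x)

end Hypotheses

end MixingRDS

namespace MixingRDS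

/-! ### Small deformations of the real line -/

section RealLine

variable {t : ℝ} {θ : ℝ → ℝ}

/-! Write `P g (u) = 𝔼 g(S(u, η))`. The proof rests on two facts: for every large `L`, `P` maps the
`[0,1]`-valued functions that are `L`-Lipschitz on `X` into themselves, and on this class
oscillations of the iterates die out uniformly.

Preservation of the class (`IsObservable.markov`). Let `h = v - u`, `A = D_η S`, `B = D_u S` at `(u,
z)`. The noise seen by `v` is replaced by `F z ≈ z + R(z) h`, where `A R(z) ≈ -B`, so that `S(v, F
z) - S(u, z)` is a small multiple of `h` plus `O(‖h‖²)`. Such a finite-rank `R(z)` exists because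
`B` is compact (`S` takes values in a compactly embedded space) and `A` has dense range for almost
every `z` (`ControlField.exists_approx_inverse`); compactness arguments make `R` Lipschitz in `z`
and the construction uniform in `u`, off a set of noises of small measure
(`Regular.exists_squeezing`). Passing from `z` to `F z` changes the law of the noise by `O(‖h‖)` in
total variation, since `F` is a composition of moves along single basis vectors and each coordinate
has a Lipschitz density (`ControlField.exists_deformation`). Hence `|P g v - P g u| ≤ (L/2 + 3C)
‖h‖` when `L ‖h‖ < 1`, which is at most `L ‖h‖` for `L ≥ 8C`; when `L ‖h‖ ≥ 1` there is nothing to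
prove.

Decay of oscillations (`exists_oscLE_iterate`). All iterates of `g` share the modulus of continuity
`L`, so they are nearly constant on one fixed ball around the reachable point. That ball is hit at a
fixed time with probability at least `δ` from everywhere in `X`, so each such period shrinks the
oscillation by the factor `1 - δ/4` until it falls below a given level.

Once `P^k g` is almost constant on `X`, the integrals of `g` against the laws at time `k` nearly
agree for all initial laws. A weak limit point of one orbit of laws then attracts all of them
(`exists_mixing_measure`), and Lipschitz functions both determine measures and control the
dual-Lipschitz distance. -/

theorem surjective_id_add_of_bounded (hc : Continuous θ) (hb : ∀ x, |θ x| ≤ t) :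
    Function.Surjective fun x => x + θ x := by
  refine Continuous.surjective (by fun_prop) ?_ ?_
  · exact tendsto_atTop_add_right_of_le _ (-t) tendsto_id fun x => (abs_le.1 (hb x)).1
  · exact tendsto_atBot_add_right_of_ge _ t tendsto_id fun x => (abs_le.1 (hb x)).2

/-- The map `x + θ x` expands distances by at least `1 - t`, and `1 / (1 - t) ≤ 1 + 2 t` for `t ≤
1/2`. Lebesgue measure is one-dimensional Hausdorff measure, so the antilipschitz bound controls
preimages without any differentiation of `θ`. -/
theorem map_id_add_le (ht0 : 0 ≤ t) (ht : t ≤ 1 / 2) (hl : ∀ x y, |θ x - θ y| ≤ t * |x - y|) :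
    (volume : Measure ℝ).map (fun x => x + θ x) ≤ ENNReal.ofReal (1 + 2 * t) • volume := by
  have hlip : LipschitzWith (Real.toNNReal t) θ :=
    LipschitzWith.of_dist_le_mul fun x y => by simpa [Real.dist_eq, ht0] using hl x y
  have hG : Continuous fun x => x + θ x := by have := hlip.continuous; fun_prop
  have hanti : AntilipschitzWith (Real.toNNReal (1 + 2 * t)) fun x => x + θ x := by
    refine AntilipschitzWith.of_le_mul_dist fun x y => ?_
    rw [Real.coe_toNNReal _ (by linarith), Real.dist_eq, Real.dist_eq]
    have h1 : |x - y| ≤ |x + θ x - (y + θ y)| + |θ x - θ y| := by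
      have := abs_sub (x + θ x - (y + θ y)) (θ x - θ y)
      rwa [show x + θ x - (y + θ y) - (θ x - θ y) = x - y by ring] at this
    have h2 := hl x y
    have h3 : (1 - t) * |x - y| ≤ |x + θ x - (y + θ y)| := by linarith
    have h4 := mul_le_mul_of_nonneg_left h3 (by linarith : 0 ≤ 1 + 2 * t)
    have h5 : 0 ≤ t * (1 - 2 * t) * |x - y| :=
      mul_nonneg (mul_nonneg ht0 (by linarith)) (abs_nonneg _)
    nlinarith
  refine Measure.le_intro fun s hs _ => ?_
  rw [Measure.map_apply hG.measurable hs]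
  simpa [← hausdorffMeasure_real, ENNReal.ofReal] using
    hanti.hausdorffMeasure_preimage_le zero_le_one s

/-- A `(1 + t)`-Lipschitz map enlarges Hausdorff measure by at most `1 + t`; surjectivity makes
every set the image of its preimage. -/
theorem le_map_id_add (ht0 : 0 ≤ t) (hb : ∀ x, |θ x| ≤ t)
    (hl : ∀ x y, |θ x - θ y| ≤ t * |x - y|) :
    (volume : Measure ℝ) ≤ ENNReal.ofReal (1 + t) • volume.map (fun x => x + θ x) := by
  have hlip : LipschitzWith (Real.toNNReal t) θ :=
    LipschitzWith.of_dist_le_mul fun x y => by simpa [Real.dist_eq, ht0] using hl x y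
  have hG : Continuous fun x => x + θ x := by have := hlip.continuous; fun_prop
  have hGl : LipschitzWith (Real.toNNReal (1 + t)) fun x => x + θ x := by
    refine LipschitzWith.of_dist_le_mul fun x y => ?_
    rw [Real.coe_toNNReal _ (by linarith), Real.dist_eq, Real.dist_eq]
    have h1 := abs_add_le (x - y) (θ x - θ y)
    rw [show x - y + (θ x - θ y) = x + θ x - (y + θ y) by ring] at h1
    linarith [hl x y]
  refine Measure.le_intro fun s hs _ => ?_
  have h := hGl.hausdorffMeasure_image_le zero_le_one ((fun x => x + θ x) ⁻¹' s)
  rw [Set.image_preimage_eq _ (surjective_id_add_of_bounded hlip.continuous hb)] at h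
  rw [Measure.smul_apply, Measure.map_apply hG.measurable hs]
  simpa [← hausdorffMeasure_real, ENNReal.ofReal] using h

/-- The two measure comparisons replace a change of variables: `∫ h ∘ G ≤ (1 + 2t) ∫ h` and `∫ h ≤
(1 + t) ∫ h ∘ G`, where `G x = x + θ x`. -/
theorem abs_integral_comp_id_add_sub_le (ht0 : 0 ≤ t) (ht : t ≤ 1 / 2) (hb : ∀ x, |θ x| ≤ t)
    (hl : ∀ x y, |θ x - θ y| ≤ t * |x - y|) {h : ℝ → ℝ} (hm : Measurable h) (h0 : ∀ x, 0 ≤ h x)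
    (hi : Integrable h) (h1 : ∫ x, h x ≤ 1) :
    Integrable (fun x => h (x + θ x)) ∧ |(∫ x, h (x + θ x)) - ∫ x, h x| ≤ 2 * t := by
  have hlip : LipschitzWith (Real.toNNReal t) θ :=
    LipschitzWith.of_dist_le_mul fun x y => by simpa [Real.dist_eq, ht0] using hl x y
  have hG : Continuous fun x => x + θ x := by have := hlip.continuous; fun_prop
  have hle := map_id_add_le ht0 ht hl
  have hge := le_map_id_add ht0 hb hl
  have hiG : Integrable h (volume.map fun x => x + θ x) :=
    (hi.smul_measure ENNReal.ofReal_ne_top).mono_measure hle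
  have e : ∫ x, h (x + θ x) = ∫ x, h x ∂(volume.map fun x => x + θ x) :=
    (integral_map hG.measurable.aemeasurable hm.aestronglyMeasurable).symm
  refine ⟨hiG.comp_measurable hG.measurable, ?_⟩
  have a1 := integral_mono_measure hle (Eventually.of_forall h0)
    (hi.smul_measure ENNReal.ofReal_ne_top)
  have a2 := integral_mono_measure hge (Eventually.of_forall h0)
    (hiG.smul_measure ENNReal.ofReal_ne_top)
  rw [integral_smul_measure, ENNReal.toReal_ofReal (by linarith), ← e, smul_eq_mul] at a2
  rw [integral_smul_measure, ENNReal.toReal_ofReal (by linarith), ← e, smul_eq_mul] at a1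
  have b0 : 0 ≤ ∫ x, h x := integral_nonneg h0
  have b1 : 0 ≤ ∫ x, h (x + θ x) := integral_nonneg fun x => h0 _
  rw [abs_le]
  constructor <;> nlinarith

/-- A probability density that is Lipschitz and compactly supported changes little, in total
variation, under small Lipschitz deformations of the line. -/
theorem exists_density_deformation_bound {ρ : ℝ → ℝ} (hρ0 : ∀ x, 0 ≤ ρ x) {L : NNReal}
    (hρL : LipschitzWith L ρ) (hρi : Integrable ρ) (hρ1 : ∫ x, ρ x = 1) {R : ℝ} (hR : 0 ≤ R)
    (hsupp : ∀ x, R < |x| → ρ x = 0) :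
    ∃ C : ℝ, 0 ≤ C ∧ ∀ t : ℝ, 0 ≤ t → ∀ θ : ℝ → ℝ, (∀ x, |θ x| ≤ t) →
      (∀ x y, |θ x - θ y| ≤ t * |x - y|) → ∀ f : ℝ → ℝ, Measurable f →
      (∀ x, f x ∈ Set.Icc (0 : ℝ) 1) →
      |(∫ x, f (x + θ x) * ρ x) - ∫ x, f x * ρ x| ≤ C * t := by
  -- For `t ≤ 1/2`, the difference `ρ x - ρ (x + θ x)` is at most `L t` and lives on `[-(R+1),
  -- R+1]`, which gives the first term; moving the variable in `f ρ` costs `2 t`. For `t > 1/2` the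
  -- trivial bound `1 ≤ 2 t` suffices.
  refine ⟨2 * (R + 1) * L + 2, by positivity, fun t ht0 θ hb hl f hf hf1 => ?_⟩
  have hlip : LipschitzWith (Real.toNNReal t) θ :=
    LipschitzWith.of_dist_le_mul fun x y => by simpa [Real.dist_eq, ht0] using hl x y
  have hG : Continuous fun x => x + θ x := by have := hlip.continuous; fun_prop
  have hρm : Measurable ρ := hρL.continuous.measurable
  have key : ∀ g : ℝ → ℝ, Measurable g → (∀ x, g x ∈ Set.Icc (0 : ℝ) 1) →
      Integrable (fun x => g x * ρ x) ∧ 0 ≤ ∫ x, g x * ρ x ∧ ∫ x, g x * ρ x ≤ 1 := by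
    intro g hg hg1
    have hi : Integrable (fun x => g x * ρ x) := by
      refine hρi.mono' (hg.mul hρm).aestronglyMeasurable (Eventually.of_forall fun x => ?_)
      rw [Real.norm_of_nonneg (mul_nonneg (hg1 x).1 (hρ0 x))]
      exact mul_le_of_le_one_left (hρ0 x) (hg1 x).2
    refine ⟨hi, integral_nonneg fun x => mul_nonneg (hg1 x).1 (hρ0 x), ?_⟩
    rw [← hρ1]
    exact integral_mono hi hρi fun x => mul_le_of_le_one_left (hρ0 x) (hg1 x).2
  obtain ⟨i1, p1, q1⟩ := key f hf hf1
  obtain ⟨i2, p2, q2⟩ := key (fun x => f (x + θ x)) (hf.comp hG.measurable) fun x => hf1 _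
  by_cases ht : t ≤ 1 / 2
  · obtain ⟨i3, hd⟩ := abs_integral_comp_id_add_sub_le ht0 ht hb hl (hf.mul hρm)
      (fun x => mul_nonneg (hf1 x).1 (hρ0 x)) i1 q1
    simp only [Pi.mul_apply] at hd i3
    have hs : ‖∫ x, (f (x + θ x) * ρ x - f (x + θ x) * ρ (x + θ x))‖ ≤ 2 * (R + 1) * L * t := by
      have hle : ∀ x, ‖f (x + θ x) * ρ x - f (x + θ x) * ρ (x + θ x)‖
          ≤ (Set.Icc (-(R + 1)) (R + 1)).indicator (fun _ => L * t) x := by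
        intro x
        by_cases hx : x ∈ Set.Icc (-(R + 1)) (R + 1)
        · rw [Set.indicator_of_mem hx, ← mul_sub, norm_mul,
            Real.norm_of_nonneg (hf1 _).1]
          refine (mul_le_of_le_one_left (norm_nonneg _) (hf1 _).2).trans ?_
          have := hρL.dist_le_mul x (x + θ x)
          rw [Real.dist_eq, Real.dist_eq] at this
          refine this.trans ?_
          gcongr
          simpa using hb x
        · rw [Set.indicator_of_notMem hx]
          have hx' : R + 1 < |x| := by
            rw [← not_le, abs_le]; exact hx
          have h1 : ρ x = 0 := hsupp x (by linarith)
          have h2 : ρ (x + θ x) = 0 := by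
            refine hsupp _ ?_
            have := abs_sub (x + θ x) (θ x)
            rw [add_sub_cancel_right] at this
            linarith [hb x]
          simp [h1, h2]
      refine (norm_integral_le_of_norm_le ?_ (Eventually.of_forall hle)).trans ?_
      · exact (integrable_indicator_iff measurableSet_Icc).2 (integrableOn_const (by simp))
      · rw [integral_indicator measurableSet_Icc, setIntegral_const, Measure.real,
          Real.volume_Icc, ENNReal.toReal_ofReal (by linarith), smul_eq_mul]
        linarith
    rw [integral_sub i2 i3, Real.norm_eq_abs] at hs
    have := abs_sub_le (∫ x, f (x + θ x) * ρ x) (∫ x, f (x + θ x) * ρ (x + θ x))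
      (∫ x, f x * ρ x)
    linarith
  · have h1 : |(∫ x, f (x + θ x) * ρ x) - ∫ x, f x * ρ x| ≤ 1 := by
      rw [abs_le]; constructor <;> linarith
    have h2 : 0 ≤ 2 * (R + 1) * L * t := by positivity
    linarith

end RealLine

/-! ### Deformations of the noise along a basis vector -/

section Noise

variable {E Ω : Type*} [NormedAddCommGroup E] [MeasurableSpace Ω] {P : Measure Ω}

/-- Since `v j = 0`, the partial sums do not involve `ξ j`, so their limit is measurable for the
σ-algebra generated by the other variables. -/
theorem indepFun_of_hasSum [NormedSpace ℝ E] [CompleteSpace E] [MeasurableSpace E] [BorelSpace E]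
    {J : Type*} [Countable J] {ξ : J → Ω → ℝ} (hξ : ∀ i, Measurable (ξ i)) (hind : iIndepFun ξ P)
    (j : J) (v : J → E) (hvj : v j = 0) {Y : Ω → E}
    (hY : ∀ᵐ ω ∂P, HasSum (fun i => ξ i ω • v i) (Y ω)) : IndepFun (ξ j) Y P := by
  let m : J → MeasurableSpace Ω := fun i => (inferInstance : MeasurableSpace ℝ).comap (ξ i)
  have hm : ∀ i, m i ≤ (inferInstance : MeasurableSpace Ω) := fun i => (hξ i).comap_le
  have hI : Indep (⨆ i ∈ ({j} : Set J), m i) (⨆ i ∈ ({j}ᶜ : Set J), m i) P :=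
    indep_iSup_of_disjoint hm hind disjoint_compl_right
  -- A version of `Y` defined everywhere from the partial sums, hence measurable for the smaller
  -- σ-algebra; `Y` itself is known only almost everywhere.
  let Y' : Ω → E := fun ω => limUnder atTop fun s : Finset J => ∑ i ∈ s, ξ i ω • v i
  have hY' : Y' =ᵐ[P] Y := by
    filter_upwards [hY] with ω hω
    exact Tendsto.limUnder_eq hω
  have hsm : StronglyMeasurable[⨆ i ∈ ({j}ᶜ : Set J), m i] Y' := by
    have hpart : ∀ s : Finset J,
        StronglyMeasurable[⨆ i ∈ ({j}ᶜ : Set J), m i] fun ω => ∑ i ∈ s, ξ i ω • v i := by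
      intro s
      refine Finset.stronglyMeasurable_fun_sum s fun i _ => ?_
      by_cases hij : i = j
      · subst hij
        simp only [hvj, smul_zero]
        exact stronglyMeasurable_const
      · have h1 : Measurable[⨆ i ∈ ({j}ᶜ : Set J), m i] (ξ i) :=
          (comap_measurable (ξ i)).mono (le_iSup₂_of_le i (by simpa using hij) le_rfl) le_rfl
        exact h1.stronglyMeasurable.smul_const (v i)
    exact @StronglyMeasurable.limUnder (Finset J) Ω E (⨆ i ∈ ({j}ᶜ : Set J), m i) _ _ atTop _ _ _ _ hpart
  refine IndepFun.congr (f := ξ j) (g := Y') ?_ EventuallyEq.rfl hY'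
  rw [IndepFun_iff_Indep]
  refine indep_of_indep_of_le_left (indep_of_indep_of_le_right hI ?_) ?_
  · exact hsm.measurable.comap_le
  · exact le_iSup₂_of_le j rfl le_rfl

/-- The essential bound kills the density almost everywhere outside `[-R, R]`, and continuity
upgrades this to every point. -/
theorem density_properties [IsProbabilityMeasure P] {X : Ω → ℝ} (hX : Measurable X) {ρ : ℝ → ℝ}
    (hρ0 : ∀ x, 0 ≤ ρ x) (hρc : Continuous ρ)
    (hlaw : P.map X = volume.withDensity fun x => ENNReal.ofReal (ρ x)) {R : ℝ}
    (hR : ∀ᵐ ω ∂P, |X ω| ≤ R) :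
    Integrable ρ ∧ ∫ x, ρ x = 1 ∧ ∀ x, R < |x| → ρ x = 0 := by
  have : IsProbabilityMeasure (P.map X) := Measure.isProbabilityMeasure_map hX.aemeasurable
  have h1 : ∫⁻ x, ENNReal.ofReal (ρ x) = 1 := by
    have := measure_univ (μ := P.map X)
    rwa [hlaw, withDensity_apply _ MeasurableSet.univ, Measure.restrict_univ] at this
  have hi : Integrable ρ := by
    refine ⟨hρc.aestronglyMeasurable, ?_⟩
    rw [hasFiniteIntegral_iff_ofReal (Eventually.of_forall hρ0), h1]
    simp
  refine ⟨hi, ?_, ?_⟩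
  · rw [integral_eq_lintegral_of_nonneg_ae (Eventually.of_forall hρ0) hρc.aestronglyMeasurable, h1]
    simp
  · have hU : IsOpen {x : ℝ | R < |x|} := isOpen_lt continuous_const continuous_abs
    have h0 : P.map X {x : ℝ | R < |x|} = 0 := by
      rw [Measure.map_apply hX hU.measurableSet]
      have : ∀ᵐ ω ∂P, ω ∉ X ⁻¹' {x : ℝ | R < |x|} := by
        filter_upwards [hR] with ω hω
        simpa using hω
      exact measure_eq_zero_iff_ae_notMem.2 this
    rw [hlaw, withDensity_apply _ hU.measurableSet,
      lintegral_eq_zero_iff (by fun_prop)] at h0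
    have h2 : ρ =ᵐ[volume.restrict {x : ℝ | R < |x|}] fun _ => 0 := by
      filter_upwards [h0] with x hx
      exact le_antisymm (by simpa using hx) (hρ0 x)
    intro x hx
    exact Measure.eqOn_open_of_ae_eq h2 hU hρc.continuousOn continuousOn_const hx

/-- The law `ℓ` is moved by at most `C t` in total variation by deformations of size `t` along `v`. -/
def DeformationBound [NormedSpace ℝ E] [MeasurableSpace E] (ℓ : Measure E) (v : E) : Prop :=
  ∃ C : ℝ, 0 ≤ C ∧ ∀ t : ℝ, 0 ≤ t → ∀ φ : E → ℝ, (∀ x, |φ x| ≤ t) →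
    (∀ x y, |φ x - φ y| ≤ t * ‖x - y‖) → ∀ f : E → ℝ, Measurable f →
    (∀ x, f x ∈ Set.Icc (0 : ℝ) 1) →
    |(∫ z, f (z + φ z • v) ∂ℓ) - ∫ z, f z ∂ℓ| ≤ C * t

/-- Conditionally on `Y = y`, the move `φ(z) v` becomes the deformation `x ↦ x + φ(y + b x v) / b`
of the line, of size at most `t / |b|` and Lipschitz constant at most `t`. Both are at most `(1 +
|b|⁻¹) t`; the one-dimensional bound is applied on each fibre and integrated over `y`. -/
theorem deformationBound_of_indepFun [NormedSpace ℝ E] [SecondCountableTopology E]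
    [MeasurableSpace E] [BorelSpace E] [IsProbabilityMeasure P]
    {ξ : Ω → ℝ} {Y η : Ω → E} (hξ : Measurable ξ) (hY : Measurable Y) (hind : IndepFun ξ Y P)
    {b : ℝ} (hb : b ≠ 0) {v : E} (hv : ‖v‖ = 1) (hη : ∀ ω, η ω = Y ω + (b * ξ ω) • v)
    {ρ : ℝ → ℝ} (hρ0 : ∀ x, 0 ≤ ρ x) {L : NNReal} (hρL : LipschitzWith L ρ)
    (hlaw : P.map ξ = volume.withDensity fun x => ENNReal.ofReal (ρ x)) {R : ℝ} (hR0 : 0 ≤ R)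
    (hR : ∀ᵐ ω ∂P, |ξ ω| ≤ R) : DeformationBound (P.map η) v := by
  obtain ⟨hρi, hρ1, hsupp⟩ := density_properties hξ hρ0 hρL.continuous hlaw hR
  obtain ⟨C, hC, hbd⟩ := exists_density_deformation_bound hρ0 hρL hρi hρ1 hR0 hsupp
  refine ⟨C * (1 + |b|⁻¹), by positivity, fun t ht φ hφ hφl f hf hf1 => ?_⟩
  have hφc : Continuous φ := by
    refine (LipschitzWith.of_dist_le_mul (K := Real.toNNReal t) fun x y => ?_).continuous
    rw [Real.dist_eq, dist_eq_norm, Real.coe_toNNReal _ ht]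
    exact hφl x y
  have hηm : Measurable η := by
    rw [show η = fun ω => Y ω + (b * ξ ω) • v from funext hη]
    fun_prop
  have : IsProbabilityMeasure (P.map Y) := Measure.isProbabilityMeasure_map hY.aemeasurable
  have : IsProbabilityMeasure (P.map ξ) := Measure.isProbabilityMeasure_map hξ.aemeasurable
  have key : ∀ g : E → ℝ, Measurable g → (∀ x, g x ∈ Set.Icc (0 : ℝ) 1) →
      Integrable (fun y => ∫ x, g (y + (b * x) • v) * ρ x) (P.map Y) ∧
      ∫ z, g z ∂(P.map η) = ∫ y, (∫ x, g (y + (b * x) • v) * ρ x) ∂(P.map Y) := by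
    intro g hg hg1
    have hmap := (indepFun_iff_map_prod_eq_prod_map_map hY.aemeasurable hξ.aemeasurable).1 hind.symm
    have hG : Measurable fun p : E × ℝ => g (p.1 + (b * p.2) • v) := hg.comp (by fun_prop)
    have hGi : Integrable (fun p : E × ℝ => g (p.1 + (b * p.2) • v)) ((P.map Y).prod (P.map ξ)) := by
      refine Integrable.of_bound hG.aestronglyMeasurable 1 (Eventually.of_forall fun p => ?_)
      rw [Real.norm_of_nonneg (hg1 _).1]
      exact (hg1 _).2
    have e1 : ∀ y, ∫ x, g (y + (b * x) • v) ∂(P.map ξ) = ∫ x, g (y + (b * x) • v) * ρ x := by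
      intro y
      rw [hlaw, integral_withDensity_eq_integral_toReal_smul
        (hρL.continuous.measurable.ennreal_ofReal) (Eventually.of_forall fun x => by simp)]
      refine integral_congr_ae (Eventually.of_forall fun x => ?_)
      simp only [ENNReal.toReal_ofReal (hρ0 x), smul_eq_mul]
      ring
    refine ⟨?_, ?_⟩
    · simpa only [e1] using hGi.integral_prod_left
    · rw [integral_map hηm.aemeasurable hg.aestronglyMeasurable]
      simp_rw [hη, ← e1]
      rw [← integral_prod _ hGi, ← hmap,
        integral_map (hY.prodMk hξ).aemeasurable hG.aestronglyMeasurable]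
  obtain ⟨i1, k1⟩ := key f hf hf1
  obtain ⟨i2, k2⟩ := key (fun z => f (z + φ z • v)) (hf.comp (by fun_prop)) fun x => hf1 _
  rw [k1, k2, ← integral_sub i2 i1, ← Real.norm_eq_abs]
  have hin : ∀ y, ‖(∫ x, f (y + (b * x) • v + φ (y + (b * x) • v) • v) * ρ x) -
      ∫ x, f (y + (b * x) • v) * ρ x‖ ≤ C * ((1 + |b|⁻¹) * t) := by
    intro y
    have hb' : 0 < |b| := abs_pos.2 hb
    have := hbd ((1 + |b|⁻¹) * t) (by positivity) (fun x => φ (y + (b * x) • v) / b) ?_ ?_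
      (fun x => f (y + (b * x) • v)) (hf.comp (by fun_prop)) fun x => hf1 _
    · refine le_of_eq_of_le ?_ this
      rw [Real.norm_eq_abs]
      congr! 6 with x
      rw [mul_add, mul_div_cancel₀ _ hb, add_smul, add_assoc]
    · intro x
      rw [abs_div, div_eq_inv_mul]
      calc |b|⁻¹ * |φ (y + (b * x) • v)| ≤ |b|⁻¹ * t := by gcongr; exact hφ _
        _ ≤ (1 + |b|⁻¹) * t := by nlinarith
    · intro x x'
      rw [← sub_div, abs_div, div_le_iff₀ hb']
      refine (hφl _ _).trans ?_
      rw [add_sub_add_left_eq_sub, ← sub_smul, norm_smul, hv, mul_one, ← mul_sub, norm_mul,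
        Real.norm_eq_abs, Real.norm_eq_abs]
      have : 0 ≤ |b|⁻¹ * t * (|x - x'| * |b|) := by positivity
      nlinarith
  refine (norm_integral_le_of_norm_le_const (Eventually.of_forall hin)).trans ?_
  simp [mul_assoc]

end Noise

theorem Decomposable.exists_basis {E Ω : Type*} [NormedAddCommGroup E] [InnerProductSpace ℝ E]
    [CompleteSpace E] [SecondCountableTopology E] [MeasurableSpace E] [BorelSpace E]
    [MeasurableSpace Ω] {P : Measure Ω} [IsProbabilityMeasure P] {η : ℕ → Ω → E}
    (h : Decomposable P η) (hη : Measurable (η 0)) {R : ℝ} (hR0 : 0 ≤ R)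
    (hR : ∀ᵐ ω ∂P, ‖η 0 ω‖ ≤ R) :
    ∃ (J : Type) (e : HilbertBasis J ℝ E), ∀ j, DeformationBound (P.map (η 0)) (e j) := by
  obtain ⟨J, _, e, b, ξ, ρ, hb, -, hξ, hind, hsum, hρ⟩ := h
  refine ⟨J, e, fun j => ?_⟩
  classical
  obtain ⟨hρ0, ⟨C, hC⟩, hlaw⟩ := hρ j
  have hind0 : iIndepFun (fun i => ξ i 0) P :=
    hind.precomp (g := fun i : J => (i, 0)) fun i i' hii => (Prod.ext_iff.1 hii).1
  have hcoord : ∀ᵐ ω ∂P, b j * ξ j 0 ω = inner ℝ (e j) (η 0 ω) := by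
    filter_upwards [hsum 0] with ω hω
    have h1 := hω.mapL (innerSL ℝ (e j))
    have h2 : HasSum (fun i => innerSL ℝ (e j) ((b i * ξ i 0 ω) • e i))
        (innerSL ℝ (e j) ((b j * ξ j 0 ω) • e j)) := by
      refine hasSum_single j fun i hi => ?_
      simp [e.orthonormal.2 (Ne.symm hi)]
    have := h2.unique h1
    simpa [inner_smul_right, e.orthonormal.1 j] using this
  have hbj : 0 < |b j| := abs_pos.2 (hb j)
  -- The remainder is defined by subtraction, so the splitting holds for every `ω`; the series is
  -- needed only almost surely, for independence. The bound `R / |b j|` comes from `b j ξ_j = ⟨e j,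
  -- η⟩`.
  refine deformationBound_of_indepFun (P := P) (ξ := ξ j 0)
    (Y := fun ω => η 0 ω - (b j * ξ j 0 ω) • e j) (b := b j) (ρ := ρ j) (L := C)
    (R := R / |b j|) (hξ j 0) (hη.sub (((hξ j 0).const_mul _).smul_const _)) ?_ (hb j)
    (e.orthonormal.1 j) (fun ω => by simp) hρ0 hC (hlaw 0) (by positivity) ?_
  · refine indepFun_of_hasSum (fun i => hξ i 0) hind0 j (fun i => if i = j then 0 else b i • e i)
      (by simp) ?_
    filter_upwards [hsum 0] with ω hω
    have h2 := hω.sub (hasSum_ite_eq j ((b j * ξ j 0 ω) • e j))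
    convert h2 using 2 with i
    by_cases hij : i = j
    · subst hij; simp
    · simp [hij, smul_smul, mul_comm]
  · filter_upwards [hcoord, hR] with ω h1 h2
    rw [le_div_iff₀ hbj, ← abs_mul, mul_comm, h1]
    refine (abs_real_inner_le_norm _ _).trans ?_
    rw [e.orthonormal.1 j, one_mul]
    exact h2

/-! ### Linear feedback fields and the deformations of the noise that realise them -/

section Fields

variable {E H J : Type*} [NormedAddCommGroup E] [NormedSpace ℝ E]
  [NormedAddCommGroup H] [NormedSpace ℝ H]

/-- Operator fields `z ↦ R z` that are finite sums of bounded Lipschitz covector fields in the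
directions `e j`. -/
inductive ControlField (e : J → E) : (E → H →L[ℝ] E) → Prop
  | zero : ControlField e fun _ => 0
  | single (j : J) (r : E → H →L[ℝ] ℝ) (C : ℝ) (hb : ∀ x, ‖r x‖ ≤ C)
      (hl : ∀ x y, ‖r x - r y‖ ≤ C * ‖x - y‖) : ControlField e fun z => (r z).smulRight (e j)
  | add (R₁ R₂ : E → H →L[ℝ] E) (h₁ : ControlField e R₁) (h₂ : ControlField e R₂) :
      ControlField e fun z => R₁ z + R₂ z

namespace ControlField

variable {e : J → E} {R : E → H →L[ℝ] E}

theorem bounded_lipschitz (hR : ControlField e R) :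
    ∃ C : ℝ, 0 ≤ C ∧ (∀ z, ‖R z‖ ≤ C) ∧ ∀ z w, ‖R z - R w‖ ≤ C * ‖z - w‖ := by
  induction hR with
  | zero => exact ⟨0, le_rfl, by simp, by simp⟩
  | single j r C hb hl =>
    have hC : 0 ≤ C := (norm_nonneg _).trans (hb 0)
    refine ⟨C * ‖e j‖, by positivity, fun z => ?_, fun z w => ?_⟩
    · rw [ContinuousLinearMap.norm_smulRight_apply]
      gcongr
      exact hb z
    · have : (r z).smulRight (e j) - (r w).smulRight (e j) = (r z - r w).smulRight (e j) := by
        ext; simp [sub_smul]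
      rw [this, ContinuousLinearMap.norm_smulRight_apply, mul_right_comm]
      gcongr
      exact hl z w
  | add R₁ R₂ _ _ ih₁ ih₂ =>
    obtain ⟨C₁, h₁, b₁, l₁⟩ := ih₁
    obtain ⟨C₂, h₂, b₂, l₂⟩ := ih₂
    refine ⟨C₁ + C₂, by positivity, fun z => ?_, fun z w => ?_⟩
    · exact (norm_add_le _ _).trans (add_le_add (b₁ z) (b₂ z))
    · rw [add_sub_add_comm, add_mul]
      exact (norm_add_le _ _).trans (add_le_add (l₁ z w) (l₂ z w))

theorem smul (hR : ControlField e R) {χ : E → ℝ} {D : ℝ} (hχ : ∀ z, |χ z| ≤ 1)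
    (hχl : ∀ z w, |χ z - χ w| ≤ D * ‖z - w‖) : ControlField e fun z => χ z • R z := by
  induction hR with
  | zero => simpa using ControlField.zero
  | single j r C hb hl =>
    have hC : 0 ≤ C := (norm_nonneg _).trans (hb 0)
    have : (fun z => χ z • (r z).smulRight (e j)) = fun z => (χ z • r z).smulRight (e j) := by
      ext; simp [smul_smul]
    rw [this]
    have key : ∀ x y, ‖χ x • r x - χ y • r y‖ ≤ (C + |D| * C) * ‖x - y‖ := fun x y => by
      have h1 : χ x • r x - χ y • r y = χ x • (r x - r y) + (χ x - χ y) • r y := by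
        ext v; simp; ring
      rw [h1, add_mul]
      refine (norm_add_le _ _).trans (add_le_add ?_ ?_)
      · rw [norm_smul, Real.norm_eq_abs]
        exact (mul_le_of_le_one_left (norm_nonneg _) (hχ x)).trans (hl x y)
      · rw [norm_smul, Real.norm_eq_abs, mul_right_comm]
        gcongr
        · exact (hχl x y).trans (by gcongr; exact le_abs_self D)
        · exact hb y
    refine ControlField.single j _ (C + |D| * C) (fun x => ?_) key
    rw [norm_smul, Real.norm_eq_abs]
    have := (mul_le_of_le_one_left (norm_nonneg (r x)) (hχ x)).trans (hb x)
    have h2 : 0 ≤ |D| * C := by positivity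
    linarith
  | add R₁ R₂ _ _ ih₁ ih₂ => simpa only [smul_add] using ControlField.add _ _ ih₁ ih₂

theorem const_smulRight (ψ : H →L[ℝ] ℝ) {v : E} (hv : v ∈ Submodule.span ℝ (Set.range e)) :
    ControlField e fun _ => ψ.smulRight v := by
  induction hv using Submodule.span_induction generalizing ψ with
  | mem x hx =>
    obtain ⟨j, rfl⟩ := hx
    exact ControlField.single j (fun _ => ψ) ‖ψ‖ (fun _ => le_rfl) fun x y => by
      simpa using by positivity
  | zero =>
    have : ψ.smulRight (0 : E) = 0 := by ext; simp
    simpa only [this] using ControlField.zero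
  | add x y _ _ hx hy =>
    have : ψ.smulRight (x + y) = ψ.smulRight x + ψ.smulRight y := by ext; simp
    simpa only [this] using ControlField.add _ _ (hx ψ) (hy ψ)
  | smul a x _ hx =>
    have : ψ.smulRight (a • x) = (a • ψ).smulRight x := by
      ext; simp [smul_smul, mul_comm]
    simpa only [this] using hx (a • ψ)

theorem sum_const {ι : Type*} (s : Finset ι) (T : ι → H →L[ℝ] E)
    (h : ∀ i ∈ s, ControlField e fun _ => T i) : ControlField e fun _ => ∑ i ∈ s, T i := by
  classical
  induction s using Finset.induction_on with
  | empty => simpa using ControlField.zero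
  | insert a s ha ih =>
    simp only [Finset.sum_insert ha]
    exact ControlField.add _ _ (h a (Finset.mem_insert_self a s))
      (ih fun i hi => h i (Finset.mem_insert_of_mem hi))

/-- A control field is realised, up to second order, by a deformation of the noise that moves its
law by at most a multiple of `‖h‖` in total variation. -/
theorem exists_deformation [MeasurableSpace E] [BorelSpace E] {ℓ : Measure E}
    (hℓ : ∀ j, DeformationBound ℓ (e j)) (hR : ControlField e R) :
    ∃ C : ℝ, 0 ≤ C ∧ ∀ h : H, ∃ F : E → E, Continuous F ∧
      (∀ f : E → ℝ, Measurable f → (∀ x, f x ∈ Set.Icc (0 : ℝ) 1) →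
        |(∫ z, f (F z) ∂ℓ) - ∫ z, f z ∂ℓ| ≤ C * ‖h‖) ∧
      (∀ z, ‖F z - z‖ ≤ C * ‖h‖) ∧ ∀ z, ‖F z - z - R z h‖ ≤ C * ‖h‖ ^ 2 := by
  induction hR with
  | zero => exact ⟨0, le_rfl, fun h => ⟨id, continuous_id, by simp, by simp, by simp⟩⟩
  | single j r C hb hl =>
    have hC : 0 ≤ C := (norm_nonneg _).trans (hb 0)
    obtain ⟨D, hD, hDb⟩ := hℓ j
    have hrc : Continuous r := by
      refine (LipschitzWith.of_dist_le_mul (K := Real.toNNReal C) fun x y => ?_).continuous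
      rw [dist_eq_norm, dist_eq_norm, Real.coe_toNNReal _ hC]
      exact hl x y
    refine ⟨D * C + C * ‖e j‖, by positivity, fun h => ⟨fun z => z + r z h • e j, by fun_prop,
      fun f hf hf1 => ?_, fun z => ?_, fun z => ?_⟩⟩
    · have := hDb (C * ‖h‖) (by positivity) (fun z => r z h) (fun z => ?_) (fun z w => ?_) f hf hf1
      · have h2 : 0 ≤ C * ‖e j‖ * ‖h‖ := by positivity
        linarith
      · exact ((r z).le_opNorm h).trans (by gcongr; exact hb z)
      · have := (r z - r w).le_opNorm h
        rw [mul_right_comm]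
        exact this.trans (by gcongr; exact hl z w)
    · rw [add_sub_cancel_left, norm_smul]
      have h1 : ‖r z h‖ * ‖e j‖ ≤ C * ‖h‖ * ‖e j‖ := by
        gcongr; exact ((r z).le_opNorm h).trans (by gcongr; exact hb z)
      have h2 : 0 ≤ D * C * ‖h‖ := by positivity
      linarith
    · simp only [add_sub_cancel_left, ContinuousLinearMap.smulRight_apply, sub_self, norm_zero]
      positivity
  | add R₁ R₂ h₁ h₂ ih₁ ih₂ =>
    obtain ⟨C₁, c₁, ih₁⟩ := ih₁
    obtain ⟨C₂, c₂, ih₂⟩ := ih₂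
    obtain ⟨D, hD, -, hDl⟩ := h₂.bounded_lipschitz
    refine ⟨C₁ + C₂ + D * C₁, by positivity, fun h => ?_⟩
    obtain ⟨F₁, m₁, v₁, s₁, t₁⟩ := ih₁ h
    obtain ⟨F₂, m₂, v₂, s₂, t₂⟩ := ih₂ h
    have hD0 : 0 ≤ D * C₁ * ‖h‖ := by positivity
    -- Under composition the total variation costs add, because the bound for `F₁` may be applied to
    -- `f ∘ F₂`. Evaluating `R₂` at `F₁ z` instead of `z` costs `D C₁ ‖h‖²`, by the Lipschitz
    -- property of `R₂`.
    refine ⟨fun z => F₂ (F₁ z), m₂.comp m₁, fun f hf hf1 => ?_, fun z => ?_, fun z => ?_⟩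
    · have a := v₁ (fun z => f (F₂ z)) (hf.comp m₂.measurable) fun x => hf1 _
      have b := v₂ f hf hf1
      have := abs_sub_le (∫ z, f (F₂ (F₁ z)) ∂ℓ) (∫ z, f (F₂ z) ∂ℓ) (∫ z, f z ∂ℓ)
      linarith
    · have := norm_sub_le_norm_sub_add_norm_sub (F₂ (F₁ z)) (F₁ z) z
      linarith [s₁ z, s₂ (F₁ z)]
    · have h3 : F₂ (F₁ z) - z - (R₁ z + R₂ z) h = (F₂ (F₁ z) - F₁ z - R₂ (F₁ z) h) +
          (F₁ z - z - R₁ z h) + (R₂ (F₁ z) - R₂ z) h := by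
        simp only [add_apply, sub_apply]; abel
      have h4 : ‖(R₂ (F₁ z) - R₂ z) h‖ ≤ D * C₁ * ‖h‖ ^ 2 := by
        calc ‖(R₂ (F₁ z) - R₂ z) h‖ ≤ ‖R₂ (F₁ z) - R₂ z‖ * ‖h‖ := ContinuousLinearMap.le_opNorm _ _
          _ ≤ D * (C₁ * ‖h‖) * ‖h‖ := by
            gcongr; exact (hDl _ _).trans (by gcongr; exact s₁ z)
          _ = D * C₁ * ‖h‖ ^ 2 := by ring
      rw [h3]
      refine (norm_add₃_le).trans ?_
      linarith [t₁ z, t₂ (F₁ z)]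

end ControlField

end Fields

/-! ### Tent functions -/

section Tent

variable {E : Type*} [NormedAddCommGroup E]

/-- The tent function that is `1` on the ball of radius `r` and vanishes outside that of radius
`2 r`. -/
noncomputable def tent (x₀ : E) (r : ℝ) (x : E) : ℝ := max 0 (min 1 (2 - ‖x - x₀‖ / r))

theorem tent_mem_Icc (x₀ : E) (r : ℝ) (x : E) : tent x₀ r x ∈ Set.Icc (0 : ℝ) 1 :=
  ⟨le_max_left _ _, max_le zero_le_one (min_le_left _ _)⟩

theorem abs_tent_sub_le (x₀ : E) {r : ℝ} (hr : 0 < r) (x y : E) :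
    |tent x₀ r x - tent x₀ r y| ≤ r⁻¹ * ‖x - y‖ := by
  unfold tent
  refine (abs_max_sub_max_le_max _ _ _ _).trans (max_le (by simpa using by positivity) ?_)
  refine (abs_min_sub_min_le_max _ _ _ _).trans (max_le (by simpa using by positivity) ?_)
  rw [sub_sub_sub_cancel_left, ← sub_div, abs_div, abs_of_pos hr, div_eq_inv_mul]
  gcongr
  have := abs_norm_sub_norm_le (y - x₀) (x - x₀)
  rwa [sub_sub_sub_cancel_right, norm_sub_rev y x] at this

theorem tent_eq_one {x₀ x : E} {r : ℝ} (hr : 0 < r) (h : ‖x - x₀‖ ≤ r) : tent x₀ r x = 1 := by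
  have : ‖x - x₀‖ / r ≤ 1 := (div_le_one hr).2 h
  rw [tent, min_eq_left (by linarith), max_eq_right zero_le_one]

theorem tent_eq_zero {x₀ x : E} {r : ℝ} (hr : 0 < r) (h : 2 * r ≤ ‖x - x₀‖) : tent x₀ r x = 0 := by
  have : 2 ≤ ‖x - x₀‖ / r := (le_div_iff₀ hr).2 h
  rw [tent, max_eq_left]
  exact (min_le_right _ _).trans (by linarith)

end Tent

/-! ### Approximate right inverses of operators with dense range -/

section ApproximateInverse

variable {E H J : Type*} [NormedAddCommGroup E] [InnerProductSpace ℝ E]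
  [NormedAddCommGroup H] [InnerProductSpace ℝ H]

/-- By compactness, `B` of the unit ball lies within `q/4` of a finite-dimensional `U`. With `w i`
an orthonormal basis of `U` and `A (ζ i) ≈ -w i`, the operator `R = ∑ ⟨w i, B ·⟩ ζ i` satisfies `A R
≈ -B`. The `ζ i` can be taken in the algebraic span of `e`, since `A` maps dense sets to dense sets.
-/
theorem ControlField.exists_approx_inverse (e : HilbertBasis J ℝ E) {A : E →L[ℝ] H}
    (hA : DenseRange A) {B : H →L[ℝ] H} (hB : IsCompactOperator B) {q : ℝ} (hq : 0 < q) :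
    ∃ R : H →L[ℝ] E, ControlField e (fun _ => R) ∧ ‖A ∘L R + B‖ < q := by
  have htb := (hB.isCompact_closure_image_closedBall (f := (B : H →ₗ[ℝ] H)) 1).totallyBounded
  obtain ⟨t, htf, ht⟩ := Metric.totallyBounded_iff.1 htb (q / 4) (by positivity)
  let U : Submodule ℝ H := Submodule.span ℝ t
  have : FiniteDimensional ℝ U := FiniteDimensional.span_of_finite ℝ htf
  have hproj : ∀ x : H, ‖x‖ = 1 → ‖B x - U.starProjection (B x)‖ ≤ q / 4 := by
    intro x hx
    have hmem : B x ∈ closure ((B : H →ₗ[ℝ] H) '' Metric.closedBall 0 1) :=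
      subset_closure ⟨x, by simp [hx], rfl⟩
    obtain ⟨y, hy, hyx⟩ := Set.mem_iUnion₂.1 (ht hmem)
    rw [Submodule.starProjection_minimal]
    refine (ciInf_le ⟨0, by rintro _ ⟨z, rfl⟩; positivity⟩
      (⟨y, Submodule.subset_span hy⟩ : U)).trans ?_
    rw [Metric.mem_ball, dist_eq_norm] at hyx
    exact hyx.le
  let w := stdOrthonormalBasis ℝ U
  set n : ℕ := Module.finrank ℝ U with hn
  -- Chosen so that the `n` errors, each at most `‖B‖ δ`, add up to at most `q/4`.
  set δ : ℝ := q / (4 * (n * ‖B‖ + 1)) with hδ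
  have hδ0 : 0 < δ := by positivity
  have hdense : ∀ i, ∃ ζ ∈ Submodule.span ℝ (Set.range e), ‖A ζ + (w i : H)‖ < δ := by
    intro i
    have hd : Dense ((Submodule.span ℝ (Set.range e) : Submodule ℝ E) : Set E) := by
      rw [Submodule.dense_iff_topologicalClosure_eq_top]
      exact e.dense_span
    obtain ⟨_, ⟨ζ, hζ, rfl⟩, hd'⟩ := (hA.dense_image A.continuous hd).exists_dist_lt
      (-(w i : H)) hδ0
    refine ⟨ζ, hζ, ?_⟩
    rwa [dist_comm, dist_eq_norm, sub_neg_eq_add] at hd'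
  choose ζ hζ hζδ using hdense
  refine ⟨∑ i, ((innerSL ℝ (w i : H)) ∘L B).smulRight (ζ i),
    ControlField.sum_const _ _ fun i _ => ControlField.const_smulRight _ (hζ i), ?_⟩
  refine (ContinuousLinearMap.opNorm_le_of_unit_norm (C := q / 2) (by positivity)
    fun x hx => ?_).trans_lt (by linarith)
  have hdecomp : (A ∘L (∑ i, ((innerSL ℝ (w i : H)) ∘L B).smulRight (ζ i)) + B) x =
      (∑ i, inner ℝ (w i : H) (B x) • (A (ζ i) + (w i : H))) +
        (B x - U.starProjection (B x)) := by
    rw [w.starProjection_eq_sum_rankOne]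
    simp only [add_apply, ContinuousLinearMap.comp_apply, sum_apply,
      ContinuousLinearMap.smulRight_apply, map_sum, map_smul, innerSL_apply_apply, smul_add, InnerProductSpace.rankOne_apply,
      Finset.sum_add_distrib]
    abel
  rw [hdecomp]
  have hsum : ‖∑ i, inner ℝ (w i : H) (B x) • (A (ζ i) + (w i : H))‖ ≤ n * (‖B‖ * δ) := by
    refine (norm_sum_le_of_le (n := fun _ => ‖B‖ * δ) _ fun i _ => ?_).trans ?_
    · rw [norm_smul]
      refine mul_le_mul ?_ (hζδ i).le (norm_nonneg _) (norm_nonneg _)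
      refine (norm_inner_le_norm _ _).trans ?_
      have h1 : ‖(w i : H)‖ = 1 := w.orthonormal.1 i
      rw [h1, one_mul]
      simpa [hx] using B.le_opNorm x
    · simp [hn]
  have h2 : n * (‖B‖ * δ) ≤ q / 4 := by
    rw [hδ, ← mul_assoc, mul_div_assoc', div_le_div_iff₀ (by positivity) (by positivity)]
    nlinarith [norm_nonneg B, Nat.cast_nonneg (α := ℝ) n]
  linarith [norm_add_le (∑ i, inner ℝ (w i : H) (B x) • (A (ζ i) + (w i : H)))
    (B x - U.starProjection (B x)), hproj x hx]

/-- Near each point of `Q` a constant approximate inverse, cut off by a tent, works for nearby `u`;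
compactness glues finitely many. The cutoff `χ` records how much of `B` is cancelled, and the error
`q χ` is demanded for all `z`, so that off `Q` at worst the uncontrolled part `(1 - χ) B` remains.
-/
theorem exists_local_controlField (e : HilbertBasis J ℝ E) {A : H × E → E →L[ℝ] H}
    {B : H × E → H →L[ℝ] H} (hA : Continuous A) (hB : Continuous B) {u₀ : H} {Q : Set E}
    (hQ : IsCompact Q) (hd : ∀ z ∈ Q, DenseRange (A (u₀, z)))
    (hc : ∀ z ∈ Q, IsCompactOperator (B (u₀, z))) {q : ℝ} (hq : 0 < q) :
    ∃ W ∈ 𝓝 u₀, ∃ (R : E → H →L[ℝ] E) (χ : E → ℝ) (D : ℝ), ControlField e R ∧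
      (∀ z, χ z ∈ Set.Icc (0 : ℝ) 1) ∧ (∀ z w, |χ z - χ w| ≤ D * ‖z - w‖) ∧
      (∀ u ∈ W, ∀ z, ‖A (u, z) ∘L R z + χ z • B (u, z)‖ ≤ q * χ z) ∧ ∀ z ∈ Q, χ z = 1 := by
  refine hQ.induction_on (p := fun s => ∃ W ∈ 𝓝 u₀, ∃ (R : E → H →L[ℝ] E) (χ : E → ℝ) (D : ℝ),
      ControlField e R ∧
      (∀ z, χ z ∈ Set.Icc (0 : ℝ) 1) ∧ (∀ z w, |χ z - χ w| ≤ D * ‖z - w‖) ∧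
      (∀ u ∈ W, ∀ z, ‖A (u, z) ∘L R z + χ z • B (u, z)‖ ≤ q * χ z) ∧ ∀ z ∈ s, χ z = 1) ?_ ?_ ?_ ?_
  · exact ⟨Set.univ, univ_mem, fun _ => 0, fun _ => 0, 0, .zero, by simp, by simp, by simp, by simp⟩
  · rintro s t hst ⟨W, hW, R, χ, D, h1, h2, h3, h4, h5⟩
    exact ⟨W, hW, R, χ, D, h1, h2, h3, h4, fun z hz => h5 z (hst hz)⟩
  · rintro s t ⟨W, hW, R, χ, D, h1, h2, h3, h4, h5⟩ ⟨W', hW', R', χ', D', h1', h2', h3', h4', h5'⟩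
    have l1 : ∀ z, |1 - χ z| ≤ 1 := fun z => by
      have := h2 z; rw [abs_le]; constructor <;> linarith [this.1, this.2]
    have l2 : ∀ z w, |(1 - χ z) - (1 - χ w)| ≤ D * ‖z - w‖ := fun z w => by
      rw [sub_sub_sub_cancel_left, abs_sub_comm]; exact h3 z w
    -- The second field acts only on the part `1 - χ` left by the first, so the new cutoff is `1 -
    -- (1 - χ)(1 - χ')` and the error bound is inherited with the same `q`.
    refine ⟨W ∩ W', inter_mem hW hW', fun z => R z + (1 - χ z) • R' z,
      fun z => χ z + (1 - χ z) * χ' z, D + (D' + D), h1.add _ _ (h1'.smul l1 l2), fun z => ?_,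
      fun z w => ?_, fun u hu z => ?_, ?_⟩
    · obtain ⟨a, b⟩ := h2 z
      obtain ⟨a', b'⟩ := h2' z
      constructor <;> nlinarith
    · have e1 : χ z + (1 - χ z) * χ' z - (χ w + (1 - χ w) * χ' w) = (χ z - χ w) +
          ((1 - χ z) * (χ' z - χ' w) + ((1 - χ z) - (1 - χ w)) * χ' w) := by ring
      rw [e1, add_mul, add_mul]
      refine (abs_add_le _ _).trans (add_le_add (h3 z w) ((abs_add_le _ _).trans
        (add_le_add ?_ ?_)))
      · rw [abs_mul]
        exact (mul_le_of_le_one_left (abs_nonneg _) (l1 z)).trans (h3' z w)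
      · rw [abs_mul]
        refine (mul_le_of_le_one_right (abs_nonneg _) ?_).trans (l2 z w)
        rw [abs_of_nonneg (h2' w).1]
        exact (h2' w).2
    · have e1 : A (u, z) ∘L (R z + (1 - χ z) • R' z) + (χ z + (1 - χ z) * χ' z) • B (u, z) =
          (A (u, z) ∘L R z + χ z • B (u, z)) +
            (1 - χ z) • (A (u, z) ∘L R' z + χ' z • B (u, z)) := by
        ext x
        simp only [add_apply, ContinuousLinearMap.comp_apply, smul_apply, map_add, map_smul,
          smul_add, add_smul, smul_smul]
        abel
      rw [e1]
      refine (norm_add_le _ _).trans ?_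
      rw [norm_smul, Real.norm_of_nonneg (by linarith [(h2 z).2])]
      have a := h4 u hu.1 z
      have b := mul_le_mul_of_nonneg_left (h4' u hu.2 z) (by linarith [(h2 z).2] : 0 ≤ 1 - χ z)
      linarith
    · rintro z (hz | hz)
      · simp [h5 z hz]
      · simp [h5' z hz]
  · intro z₀ hz₀
    obtain ⟨R, hR, hRq⟩ := ControlField.exists_approx_inverse e (hd z₀ hz₀) (hc z₀ hz₀) hq
    have hcont : Continuous fun p : H × E => ‖A p ∘L R + B p‖ :=
      ((hA.clm_comp continuous_const).add hB).norm
    have hnh : {p : H × E | ‖A p ∘L R + B p‖ < q} ∈ 𝓝 (u₀, z₀) :=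
      (isOpen_lt hcont continuous_const).mem_nhds hRq
    obtain ⟨W, hW, Z, hZ, hWZ⟩ := mem_nhds_prod_iff.1 hnh
    obtain ⟨r, hr, hrZ⟩ := Metric.mem_nhds_iff.1 hZ
    have hr2 : 0 < r / 2 := by positivity
    refine ⟨Metric.closedBall z₀ (r / 2),
      mem_nhdsWithin_of_mem_nhds (Metric.closedBall_mem_nhds _ hr2), W, hW,
      fun z => tent z₀ (r / 2) z • R, tent z₀ (r / 2), (r / 2)⁻¹,
      hR.smul (fun z => ?_) (abs_tent_sub_le z₀ hr2), tent_mem_Icc z₀ _, abs_tent_sub_le z₀ hr2,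
      fun u hu z => ?_, fun z hz => ?_⟩
    · rw [abs_of_nonneg (tent_mem_Icc z₀ _ z).1]
      exact (tent_mem_Icc z₀ _ z).2
    · rw [ContinuousLinearMap.comp_smul, ← smul_add, norm_smul,
        Real.norm_of_nonneg (tent_mem_Icc z₀ _ z).1, mul_comm]
      by_cases hz : ‖z - z₀‖ < r
      · refine mul_le_mul_of_nonneg_right ?_ (tent_mem_Icc z₀ _ z).1
        have : (u, z) ∈ W ×ˢ Z := ⟨hu, hrZ (by rwa [Metric.mem_ball, dist_eq_norm])⟩
        exact (hWZ this).le
      · rw [tent_eq_zero hr2 (by linarith)]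
        simp
    · exact tent_eq_one hr2 (by rwa [Metric.mem_closedBall, dist_eq_norm] at hz)

end ApproximateInverse

/-! ### Differentiability of the dynamics -/

section Regularity

variable {H E V : Type*}
  [NormedAddCommGroup H] [InnerProductSpace ℝ H]
  [NormedAddCommGroup E] [InnerProductSpace ℝ E]
  [NormedAddCommGroup V] [InnerProductSpace ℝ V] {emb : V →L[ℝ] H} {S : H × E → H}

theorem Regular.contDiff (h : Regular emb S) : ContDiff ℝ 2 S := by
  obtain ⟨⟨T, hT, hTc, -⟩, -⟩ := h
  rw [show S = fun x => emb (T x) from funext hT]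
  exact emb.contDiff.comp hTc

/-- The derivative factors through the compact embedding `emb`. -/
theorem Regular.isCompactOperator_fderiv (h : Regular emb S) (hemb : IsCompactOperator emb)
    (x : H × E) : IsCompactOperator (fderiv ℝ S x ∘L ContinuousLinearMap.inl ℝ H E) := by
  obtain ⟨⟨T, hT, hTc, -⟩, -⟩ := h
  have hd : HasFDerivAt T (fderiv ℝ T x) x :=
    (hTc.differentiable (by norm_num) x).hasFDerivAt
  have : fderiv ℝ S x = emb ∘L fderiv ℝ T x := by
    rw [show S = fun x => emb (T x) from funext hT]
    exact (emb.hasFDerivAt.comp x hd).fderiv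
  rw [this, ContinuousLinearMap.comp_assoc]
  exact hemb.comp_clm _

/-- Mean value inequality twice: the bound on the second derivative of `T` makes `fderiv ℝ T`
Lipschitz on the ball, and this bounds the remainder along segments. Balls need not be compact, so
boundedness on bounded sets is what makes `M` uniform. -/
theorem Regular.exists_taylor_bound (h : Regular emb S) (r : ℝ) :
    ∃ M : ℝ, 0 ≤ M ∧ ∀ x ∈ Metric.closedBall (0 : H × E) r, ∀ y ∈ Metric.closedBall (0 : H × E) r,
      ‖S y - S x - fderiv ℝ S x (y - x)‖ ≤ M * ‖y - x‖ ^ 2 := by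
  have hS := h.contDiff
  obtain ⟨⟨T, hT, hTc, hTb⟩, -⟩ := h
  obtain ⟨C, hC⟩ := hTb 2 (by norm_num) le_rfl _ (Metric.isBounded_closedBall (x := (0 : H × E)) (r := r))
  have hTd : Differentiable ℝ T := hTc.differentiable (by norm_num)
  have hTd' : Differentiable ℝ (fderiv ℝ T) :=
    (hTc.fderiv_right (m := 1) (by norm_num)).differentiable (by norm_num)
  have hconv : Convex ℝ (Metric.closedBall (0 : H × E) r) := convex_closedBall _ _
  have hlip : ∀ x ∈ Metric.closedBall (0 : H × E) r, ∀ y ∈ Metric.closedBall (0 : H × E) r,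
      ‖fderiv ℝ T y - fderiv ℝ T x‖ ≤ |C| * ‖y - x‖ := by
    intro x hx y hy
    refine Convex.norm_image_sub_le_of_norm_fderiv_le (𝕜 := ℝ) (f := fderiv ℝ T)
      (s := Metric.closedBall (0 : H × E) r) (fun z _ => hTd' z) (fun z hz => ?_) hconv hx hy
    refine le_trans (le_of_eq ?_) ((hC z hz).trans (le_abs_self C))
    rw [← norm_iteratedFDeriv_fderiv (n := 1), ← norm_iteratedFDeriv_fderiv (n := 0),
      norm_iteratedFDeriv_zero]
  refine ⟨‖emb‖ * |C|, by positivity, fun x hx y hy => ?_⟩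
  have hseg : ‖T y - T x - fderiv ℝ T x (y - x)‖ ≤ (|C| * ‖y - x‖) * ‖y - x‖ := by
    refine (convex_segment x y).norm_image_sub_le_of_norm_fderiv_le' (fun z _ => hTd z)
      (fun z hz => ?_) (left_mem_segment ℝ x y) (right_mem_segment ℝ x y)
    refine (hlip x hx z (hconv.segment_subset hx hy hz)).trans ?_
    gcongr
    exact norm_sub_le_of_mem_segment hz
  have hder : fderiv ℝ S x = emb ∘L fderiv ℝ T x := by
    rw [show S = fun x => emb (T x) from funext hT]
    exact (emb.hasFDerivAt.comp x (hTd x).hasFDerivAt).fderiv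
  rw [hT, hT, hder, ContinuousLinearMap.comp_apply, ← map_sub, ← map_sub]
  refine (emb.le_opNorm _).trans ?_
  rw [mul_assoc, pow_two, ← mul_assoc |C|]
  gcongr

theorem fderiv_partial_right (hS : Differentiable ℝ S) (u : H) (z : E) :
    fderiv ℝ (fun ζ : E => S (u, ζ)) z = fderiv ℝ S (u, z) ∘L ContinuousLinearMap.inr ℝ H E :=
  ((hS (u, z)).hasFDerivAt.comp z (hasFDerivAt_prodMk_right u z)).fderiv

end Regularity

/-! ### Deformations of the noise that bring neighbouring trajectories together -/

section Squeezing

variable {H E : Type*} [NormedAddCommGroup H] [NormedAddCommGroup E] [MeasurableSpace E]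
  {S : H × E → H}

/-- The deformation `F` of the noise steers the trajectory issued from `v` towards that issued from
`u`: up to an error of order `C ‖v - u‖²` the distance is multiplied by at most `Λ`, and by at most
`q` outside a set of noises of measure `σ`; the law of the noise moves by at most `C ‖v - u‖`. -/
structure IsSqueezing (ℓ : Measure E) (S : H × E → H) (K : Set E) (q σ Λ C : ℝ) (u v : H)
    (F : E → E) (Q : Set E) : Prop where
  continuous : Continuous F
  measurableSet : MeasurableSet Q
  measure_compl_le : ℓ.real Qᶜ ≤ σ
  variation_le : ∀ f : E → ℝ, Measurable f → (∀ x, f x ∈ Set.Icc (0 : ℝ) 1) →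
    |(∫ z, f (F z) ∂ℓ) - ∫ z, f z ∂ℓ| ≤ C * ‖v - u‖
  dist_le : ∀ z ∈ K, ‖S (v, F z) - S (u, z)‖ ≤ Λ * ‖v - u‖ + C * ‖v - u‖ ^ 2
  dist_le_of_mem : ∀ z ∈ K ∩ Q, ‖S (v, F z) - S (u, z)‖ ≤ q * ‖v - u‖ + C * ‖v - u‖ ^ 2

/-- The property `p` need not be measurable: a measurable null set containing its failures is
removed first, then inner regularity applies. -/
theorem exists_isCompact_of_ae [CompleteSpace E] [SecondCountableTopology E] [BorelSpace E]
    {ℓ : Measure E} [IsProbabilityMeasure ℓ] {p : E → Prop} (hp : ∀ᵐ z ∂ℓ, p z) {σ : ℝ}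
    (hσ : 0 < σ) : ∃ Q : Set E, IsCompact Q ∧ (∀ z ∈ Q, p z) ∧ ℓ.real Qᶜ ≤ σ := by
  obtain ⟨N, hpN, hNm, hN⟩ := exists_measurable_superset_of_null (ae_iff.1 hp)
  obtain ⟨Q, hQN, hQc, hQ⟩ := hNm.compl.exists_isCompact_lt_add (μ := ℓ) (measure_ne_top _ _)
    (ε := ENNReal.ofReal σ) (by simpa using hσ)
  refine ⟨Q, hQc, fun z hz => by_contra fun h => hQN hz (hpN h), ?_⟩
  rw [prob_compl_eq_one_iff hNm |>.2 hN] at hQ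
  rw [probReal_compl_eq_one_sub hQc.measurableSet]
  have h1 := ENNReal.toReal_mono (by finiteness) hQ.le
  rw [ENNReal.toReal_add (measure_ne_top _ _) ENNReal.ofReal_ne_top, ENNReal.toReal_ofReal hσ.le,
    ENNReal.toReal_one] at h1
  simp only [Measure.real]
  linarith

theorem IsSqueezing.mono {ℓ : Measure E} {K : Set E} {q σ Λ C C' : ℝ} {u v : H} {F : E → E}
    {Q : Set E} (h : IsSqueezing ℓ S K q σ Λ C u v F Q) (hC : C ≤ C') :
    IsSqueezing ℓ S K q σ Λ C' u v F Q where
  continuous := h.continuous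
  measurableSet := h.measurableSet
  measure_compl_le := h.measure_compl_le
  variation_le f hf hf1 := (h.variation_le f hf hf1).trans (by gcongr)
  dist_le z hz := (h.dist_le z hz).trans (by gcongr)
  dist_le_of_mem z hz := (h.dist_le_of_mem z hz).trans (by gcongr)

/-- With `h = v - u` and `k = F z - z`, the linear part of `S(v, F z) - S(u, z)` splits as `(A R + χ
B) h + (1 - χ) B h + A (k - R h)`. The first term is at most `q χ ‖h‖`, the second at most `(1 - χ)
Λ ‖h‖` and vanishes on `Q`, the third is quadratic. -/
theorem Regular.exists_squeezing {V J : Type*} [InnerProductSpace ℝ H] [InnerProductSpace ℝ E]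
    [NormedAddCommGroup V] [InnerProductSpace ℝ V] {emb : V →L[ℝ] H} [CompleteSpace E] [SecondCountableTopology E] [BorelSpace E]
    {ℓ : Measure E} [IsProbabilityMeasure ℓ] (hS : Regular emb S) (hemb : IsCompactOperator emb)
    {X : Set H} (hX : IsCompact X) {K : Set E} (hK : IsCompact K) (h3 : LinControllable S X ℓ)
    (e : HilbertBasis J ℝ E) (hℓ : ∀ j, DeformationBound ℓ (e j)) {q σ Λ : ℝ} (hq : 0 < q)
    (hσ : 0 < σ) (hqΛ : q ≤ Λ)
    (hΛ : ∀ u ∈ X, ∀ z ∈ K, ‖fderiv ℝ S (u, z) ∘L ContinuousLinearMap.inl ℝ H E‖ ≤ Λ) :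
    ∃ C : ℝ, 0 ≤ C ∧ ∀ u ∈ X, ∀ v ∈ X, ∃ F Q, IsSqueezing ℓ S K q σ Λ C u v F Q := by
  have hSd : Differentiable ℝ S := hS.contDiff.differentiable (by norm_num)
  have hSc : Continuous (fderiv ℝ S) := hS.contDiff.continuous_fderiv (by norm_num)
  let A : H × E → E →L[ℝ] H := fun x => fderiv ℝ S x ∘L ContinuousLinearMap.inr ℝ H E
  let B : H × E → H →L[ℝ] H := fun x => fderiv ℝ S x ∘L ContinuousLinearMap.inl ℝ H E
  have hA : Continuous A := hSc.clm_comp continuous_const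
  have hB : Continuous B := hSc.clm_comp continuous_const
  obtain ⟨a, ha⟩ := (hX.prod hK).exists_bound_of_continuousOn hA.continuousOn
  obtain ⟨rX, hrX⟩ := hX.isBounded.exists_norm_le
  obtain ⟨rK, hrK⟩ := hK.isBounded.exists_norm_le
  -- The neighbourhoods used in the compactness induction are not contained in `X`, so membership in
  -- `X` is carried as a separate hypothesis.
  suffices h : ∃ C : ℝ, 0 ≤ C ∧ ∀ u ∈ X, u ∈ X → ∀ v ∈ X, ∃ F Q,
      IsSqueezing ℓ S K q σ Λ C u v F Q by
    obtain ⟨C, hC, h⟩ := h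
    exact ⟨C, hC, fun u hu => h u hu hu⟩
  refine hX.induction_on (p := fun s => ∃ C : ℝ, 0 ≤ C ∧ ∀ u ∈ s, u ∈ X → ∀ v ∈ X, ∃ F Q,
    IsSqueezing ℓ S K q σ Λ C u v F Q) ⟨0, le_rfl, by simp⟩ ?_ ?_ ?_
  · rintro s t hst ⟨C, hC, h⟩
    exact ⟨C, hC, fun u hu => h u (hst hu)⟩
  · rintro s t ⟨C, hC, h⟩ ⟨C', hC', h'⟩
    refine ⟨max C C', le_max_of_le_left hC, ?_⟩
    rintro u (hu | hu) huX v hv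
    · obtain ⟨F, Q, hF⟩ := h u hu huX v hv
      exact ⟨F, Q, hF.mono (le_max_left _ _)⟩
    · obtain ⟨F, Q, hF⟩ := h' u hu huX v hv
      exact ⟨F, Q, hF.mono (le_max_right _ _)⟩
  intro u₀ hu₀
  obtain ⟨Q, hQc, hQD, hQσ⟩ := exists_isCompact_of_ae (h3 u₀ hu₀) hσ
  obtain ⟨W, hW, R, χ, -, hR, hχ, -, hRW, hχQ⟩ := exists_local_controlField e hA hB (u₀ := u₀) hQc
    (fun z hz => by
      have := hQD z hz
      rwa [fderiv_partial_right hSd] at this)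
    (fun z _ => hS.isCompactOperator_fderiv hemb _) hq
  obtain ⟨C, hC, hF⟩ := hR.exists_deformation hℓ
  -- The radius accommodates both `(u, z)` and `(v, F z)`, as `‖F z - z‖ ≤ C ‖v - u‖` and `‖v - u‖ ≤
  -- 2 |rX|`.
  obtain ⟨M, hM, hTaylor⟩ := hS.exists_taylor_bound (|rX| + |rK| + C * (2 * |rX|))
  -- The three terms come from the Taylor remainder, from `A (k - R h)`, and from the change of the
  -- law of the noise.
  refine ⟨W, mem_nhdsWithin_of_mem_nhds hW, M * (1 + C) ^ 2 + |a| * C + C, by positivity,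
    fun u hu huX v hv => ?_⟩
  obtain ⟨F, hFc, hFv, hF1, hF2⟩ := hF (v - u)
  have key : ∀ z ∈ K, ‖S (v, F z) - S (u, z)‖ ≤ (q * χ z + (1 - χ z) * Λ) * ‖v - u‖ +
      (M * (1 + C) ^ 2 + |a| * C + C) * ‖v - u‖ ^ 2 := by
    intro z hz
    set h := v - u with hh
    set k := F z - z with hk
    have nu : ‖u‖ ≤ |rX| := (hrX u huX).trans (le_abs_self _)
    have nv : ‖v‖ ≤ |rX| := (hrX v hv).trans (le_abs_self _)
    have nz : ‖z‖ ≤ |rK| := (hrK z hz).trans (le_abs_self _)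
    have nh : ‖h‖ ≤ 2 * |rX| := (norm_sub_le _ _).trans (by linarith)
    have nk : ‖k‖ ≤ C * ‖h‖ := hF1 z
    have nF : ‖F z‖ ≤ |rK| + C * (2 * |rX|) := by
      have : F z = z + k := by simp [hk]
      rw [this]
      refine (norm_add_le _ _).trans (add_le_add nz (nk.trans ?_))
      gcongr
    have hx : (u, z) ∈ Metric.closedBall (0 : H × E) (|rX| + |rK| + C * (2 * |rX|)) := by
      rw [mem_closedBall_zero_iff, Prod.norm_def]
      have : 0 ≤ C * (2 * |rX|) := by positivity
      refine max_le ?_ ?_ <;> simp only <;> linarith [abs_nonneg rX, abs_nonneg rK]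
    have hy : (v, F z) ∈ Metric.closedBall (0 : H × E) (|rX| + |rK| + C * (2 * |rX|)) := by
      rw [mem_closedBall_zero_iff, Prod.norm_def]
      have : 0 ≤ C * (2 * |rX|) := by positivity
      refine max_le ?_ ?_ <;> simp only <;> linarith [abs_nonneg rX, abs_nonneg rK]
    have hT := hTaylor _ hx _ hy
    have hyx : (v, F z) - (u, z) = (h, k) := rfl
    have hnorm : ‖(h, k)‖ ≤ (1 + C) * ‖h‖ := by
      rw [Prod.norm_def]
      have : 0 ≤ C * ‖h‖ := by positivity
      refine max_le ?_ ?_ <;> simp only <;> linarith [norm_nonneg h]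
    rw [hyx] at hT
    have hsplit : fderiv ℝ S (u, z) (h, k) = (A (u, z) ∘L R z + χ z • B (u, z)) h +
        (1 - χ z) • B (u, z) h + A (u, z) (k - R z h) := by
      have : (h, k) = ContinuousLinearMap.inl ℝ H E h + ContinuousLinearMap.inr ℝ H E k := by simp
      rw [this, map_add]
      simp only [add_apply, ContinuousLinearMap.comp_apply, smul_apply, map_sub, sub_smul, one_smul,
        A, B]
      abel
    have n1 : ‖(A (u, z) ∘L R z + χ z • B (u, z)) h‖ ≤ q * χ z * ‖h‖ :=
      (ContinuousLinearMap.le_opNorm _ _).trans (by gcongr; exact hRW u hu z)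
    have n2 : ‖(1 - χ z) • B (u, z) h‖ ≤ (1 - χ z) * Λ * ‖h‖ := by
      have h0 : 0 ≤ 1 - χ z := by linarith [(hχ z).2]
      rw [norm_smul, Real.norm_of_nonneg h0, mul_assoc]
      gcongr
      exact (ContinuousLinearMap.le_opNorm _ _).trans (by gcongr; exact hΛ u huX z hz)
    have n3 : ‖A (u, z) (k - R z h)‖ ≤ |a| * (C * ‖h‖ ^ 2) := by
      refine (ContinuousLinearMap.le_opNorm _ _).trans ?_
      gcongr
      · exact (ha (u, z) ⟨huX, hz⟩).trans (le_abs_self a)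
      · exact hF2 z
    have n4 : M * ‖(h, k)‖ ^ 2 ≤ M * ((1 + C) * ‖h‖) ^ 2 := by gcongr
    have n5 : ‖fderiv ℝ S (u, z) (h, k)‖ ≤ (q * χ z + (1 - χ z) * Λ) * ‖h‖ + |a| * C * ‖h‖ ^ 2 := by
      rw [hsplit]
      refine norm_add₃_le.trans ?_
      linarith
    have n6 : S (v, F z) - S (u, z) = (S (v, F z) - S (u, z) - fderiv ℝ S (u, z) (h, k)) +
        fderiv ℝ S (u, z) (h, k) := by abel
    rw [n6]
    refine (norm_add_le _ _).trans ?_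
    have n7 : 0 ≤ C * ‖h‖ ^ 2 := by positivity
    nlinarith
  refine ⟨F, Q, hFc, hQc.measurableSet, hQσ, fun f hf hf1 => (hFv f hf hf1).trans ?_,
    fun z hz => (key z hz).trans ?_, fun z hz => (key z hz.1).trans ?_⟩
  · gcongr
    have : 0 ≤ M * (1 + C) ^ 2 + |a| * C := by positivity
    linarith
  · gcongr
    nlinarith [(hχ z).1, (hχ z).2]
  · gcongr
    rw [hχQ z hz.2]
    linarith

end Squeezing

/-! ### The Markov semigroup on Lipschitz observables -/

section Observables

variable {H E : Type*} [MeasurableSpace H] [MeasurableSpace E] {ℓ : Measure E} {S : H × E → H}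
  {X : Set H} {K : Set E} {L : ℝ} {g : H → ℝ}

/-- The Markov operator `g ↦ 𝔼 g(S(·, η))` of the random dynamical system with noise law `ℓ`. -/
noncomputable def markov (ℓ : Measure E) (S : H × E → H) (g : H → ℝ) (u : H) : ℝ :=
  ∫ z, g (S (u, z)) ∂ℓ

/-- Measurable `[0, 1]`-valued functions. -/
structure IsUnitValued (g : H → ℝ) : Prop where
  measurable : Measurable g
  mem_Icc : ∀ u, g u ∈ Set.Icc (0 : ℝ) 1

theorem IsUnitValued.integrable {α : Type*} [MeasurableSpace α] {μ : Measure α}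
    [IsFiniteMeasure μ] (hg : IsUnitValued g) {φ : α → H} (hφ : Measurable φ) :
    Integrable (fun a => g (φ a)) μ := by
  refine Integrable.of_bound (hg.measurable.comp hφ).aestronglyMeasurable 1
    (Eventually.of_forall fun a => ?_)
  rw [Real.norm_of_nonneg (hg.mem_Icc _).1]
  exact (hg.mem_Icc _).2

theorem IsUnitValued.integral_mem_Icc {α : Type*} [MeasurableSpace α] {μ : Measure α}
    [IsProbabilityMeasure μ] (hg : IsUnitValued g) {φ : α → H} (hφ : Measurable φ) :
    ∫ a, g (φ a) ∂μ ∈ Set.Icc (0 : ℝ) 1 := by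
  refine ⟨integral_nonneg fun a => (hg.mem_Icc _).1, ?_⟩
  simpa using integral_mono (hg.integrable (μ := μ) hφ) (integrable_const (1 : ℝ))
    fun a => (hg.mem_Icc (φ a)).2

theorem IsUnitValued.markov [IsProbabilityMeasure ℓ] (hS : Measurable S)
    (hg : IsUnitValued g) : IsUnitValued (markov ℓ S g) := by
  refine ⟨?_, fun u => hg.integral_mem_Icc (by fun_prop)⟩
  exact (StronglyMeasurable.integral_prod_right (f := fun u z => g (S (u, z)))
    (hg.measurable.comp hS).stronglyMeasurable).measurable

theorem IsUnitValued.markov_iterate [IsProbabilityMeasure ℓ] (hS : Measurable S)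
    (hg : IsUnitValued g) (m : ℕ) : IsUnitValued ((MixingRDS.markov ℓ S)^[m] g) := by
  induction m with
  | zero => exact hg
  | succ m ih =>
    rw [Function.iterate_succ_apply']
    exact ih.markov hS

variable [NormedAddCommGroup H] [NormedAddCommGroup E]

/-- Measurable `[0, 1]`-valued functions that are `L`-Lipschitz on `X`. -/
structure IsObservable (X : Set H) (L : ℝ) (g : H → ℝ) : Prop extends IsUnitValued g where
  lipschitz : ∀ u ∈ X, ∀ v ∈ X, |g u - g v| ≤ L * ‖u - v‖

/-- A squeezing deformation of the noise makes the Markov operator preserve the Lipschitz constant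
of observables, once that constant is large enough. -/
theorem IsObservable.markov [BorelSpace H] [BorelSpace E] [SecondCountableTopologyEither H E]
    [IsProbabilityMeasure ℓ] (hS : Continuous S) (hK : IsClosed K) (hKℓ : ∀ᵐ z ∂ℓ, z ∈ K)
    (hinv : ∀ u ∈ X, ∀ z ∈ K, S (u, z) ∈ X) {σ Λ C : ℝ} (hΛ : 0 ≤ Λ) (hC : 0 ≤ C)
    (hσ : σ * Λ ≤ 1 / 4)
    (hF : ∀ u ∈ X, ∀ v ∈ X, ∃ F Q, IsSqueezing ℓ S K (1 / 4) σ Λ C u v F Q)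
    (hL : 8 * C ≤ L) (hg : IsObservable X L g) : IsObservable X L (markov ℓ S g) := by
  have hu := hg.toIsUnitValued.markov (ℓ := ℓ) hS.measurable
  have hSm : Measurable S := hS.measurable
  refine ⟨hu, fun v hv u hu' => ?_⟩
  set d := ‖v - u‖ with hd
  have hd0 : 0 ≤ d := norm_nonneg _
  have hL0 : 0 ≤ L := by linarith
  -- If `L d ≥ 1`, the bound is trivial for `[0,1]`-valued functions; the other case absorbs the
  -- quadratic error through `L C d² ≤ C d`.
  by_cases hLd : 1 ≤ L * d
  · have h1 := hu.mem_Icc u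
    have h2 := hu.mem_Icc v
    refine le_trans ?_ hLd
    rw [abs_le]; constructor <;> linarith [h1.1, h1.2, h2.1, h2.2]
  obtain ⟨F, Q, h⟩ := hF u hu' v hv
  have hFm : Measurable F := h.continuous.measurable
  have a1 := h.variation_le (fun z => g (S (v, z))) (hg.measurable.comp (by fun_prop))
    fun z => hg.mem_Icc _
  -- `F` may push noises out of `K`, where `S` need not preserve `X`. As `Kᶜ` is `ℓ`-null, the
  -- variation bound for its indicator shows that this has probability at most `C d`.
  have a2 : ℓ.real (F ⁻¹' Kᶜ) ≤ C * d := by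
    have hKm := hK.measurableSet.compl
    have := h.variation_le (Kᶜ.indicator fun _ => 1) (measurable_const.indicator hKm)
      fun z => by by_cases hz : z ∈ Kᶜ <;> simp [hz]
    have e2 : ∫ z, Kᶜ.indicator (fun _ => (1 : ℝ)) z ∂ℓ = ℓ.real Kᶜ := integral_indicator_one hKm
    have e0 : ℓ.real Kᶜ = 0 := by
      rw [Measure.real, show ℓ Kᶜ = 0 from mem_ae_iff.1 hKℓ, ENNReal.toReal_zero]
    have e1 : ∫ z, Kᶜ.indicator (fun _ => (1 : ℝ)) (F z) ∂ℓ = ℓ.real (F ⁻¹' Kᶜ) := by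
      rw [← integral_indicator_one (hFm hKm)]
      rfl
    rw [e2, e0, e1, sub_zero] at this
    exact (le_abs_self _).trans this
  have hpt : ∀ᵐ z ∂ℓ, ‖g (S (v, F z)) - g (S (u, z))‖ ≤ L * (1 / 4 * d + C * d ^ 2) +
      ((L * Λ * d) * Qᶜ.indicator (fun _ => (1 : ℝ)) z +
        (F ⁻¹' Kᶜ).indicator (fun _ => (1 : ℝ)) z) := by
    filter_upwards [hKℓ] with z hz
    rw [Real.norm_eq_abs]
    have hb0 : 0 ≤ L * (1 / 4 * d + C * d ^ 2) := by positivity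
    have hb1 : 0 ≤ L * Λ * d := by positivity
    have i0 : ∀ s : Set E, 0 ≤ s.indicator (fun _ => (1 : ℝ)) z := fun s =>
      Set.indicator_nonneg (fun _ _ => zero_le_one) _
    by_cases hFz : F z ∈ K
    · have hl := hg.lipschitz _ (hinv v hv _ hFz) _ (hinv u hu' _ hz)
      by_cases hzQ : z ∈ Q
      · have := mul_le_mul_of_nonneg_left (h.dist_le_of_mem z ⟨hz, hzQ⟩) hL0
        have j1 := mul_nonneg hb1 (i0 Qᶜ)
        linarith [i0 (F ⁻¹' Kᶜ)]
      · have := mul_le_mul_of_nonneg_left (h.dist_le z hz) hL0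
        rw [Set.indicator_of_mem (by simpa using hzQ : z ∈ Qᶜ)]
        have : 0 ≤ L * (1 / 4 * d) := by positivity
        linarith [i0 (F ⁻¹' Kᶜ)]
    · have j1 := mul_nonneg hb1 (i0 Qᶜ)
      rw [Set.indicator_of_mem (by simpa using hFz : z ∈ F ⁻¹' Kᶜ)]
      have h1 := hg.mem_Icc (S (u, z))
      have h2 := hg.mem_Icc (S (v, F z))
      have : |g (S (v, F z)) - g (S (u, z))| ≤ 1 := by
        rw [abs_le]; constructor <;> linarith [h1.1, h1.2, h2.1, h2.2]
      linarith
  have hmQ := h.measurableSet.compl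
  have hmF : MeasurableSet (F ⁻¹' Kᶜ) := hFm hK.measurableSet.compl
  have iQ : Integrable (Qᶜ.indicator fun _ => (1 : ℝ)) ℓ := (integrable_const _).indicator hmQ
  have iF : Integrable ((F ⁻¹' Kᶜ).indicator fun _ => (1 : ℝ)) ℓ :=
    (integrable_const _).indicator hmF
  have a3 := norm_integral_le_of_norm_le
    ((integrable_const (L * (1 / 4 * d + C * d ^ 2))).add ((iQ.const_mul (L * Λ * d)).add iF)) hpt
  rw [integral_sub (hg.integrable (by fun_prop)) (hg.integrable (by fun_prop)), Real.norm_eq_abs]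
    at a3
  have eQ : ∫ z, Qᶜ.indicator (fun _ => (1 : ℝ)) z ∂ℓ = ℓ.real Qᶜ := integral_indicator_one hmQ
  have eF : ∫ z, (F ⁻¹' Kᶜ).indicator (fun _ => (1 : ℝ)) z ∂ℓ = ℓ.real (F ⁻¹' Kᶜ) :=
    integral_indicator_one hmF
  have eI : ∫ z, (L * (1 / 4 * d + C * d ^ 2) + ((L * Λ * d) * Qᶜ.indicator (fun _ => (1 : ℝ)) z +
      (F ⁻¹' Kᶜ).indicator (fun _ => (1 : ℝ)) z)) ∂ℓ =
      L * (1 / 4 * d + C * d ^ 2) + (L * Λ * d * ℓ.real Qᶜ + ℓ.real (F ⁻¹' Kᶜ)) := by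
    have i2 : Integrable (fun z => (L * Λ * d) * Qᶜ.indicator (fun _ => (1 : ℝ)) z +
        (F ⁻¹' Kᶜ).indicator (fun _ => (1 : ℝ)) z) ℓ := (iQ.const_mul _).add iF
    rw [integral_add (integrable_const _) i2, integral_add (iQ.const_mul _) iF, integral_const_mul (L * Λ * d), eQ, eF]
    simp
  replace a3 := a3.trans_eq eI
  have a4 : L * Λ * d * ℓ.real Qᶜ ≤ L * d * (1 / 4) := by
    have h5 : Λ * ℓ.real Qᶜ ≤ 1 / 4 := by
      have := mul_le_mul_of_nonneg_left h.measure_compl_le hΛ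
      linarith
    have := mul_le_mul_of_nonneg_left h5 (by positivity : 0 ≤ L * d)
    linarith
  have a5 : L * (C * d ^ 2) ≤ C * d := by
    have := mul_le_mul_of_nonneg_left (not_le.1 hLd).le (by positivity : 0 ≤ C * d)
    linarith
  have a6 : 8 * C * d ≤ L * d := by gcongr
  have a7 := abs_sub_le (∫ z, g (S (v, z)) ∂ℓ) (∫ z, g (S (v, F z)) ∂ℓ) (∫ z, g (S (u, z)) ∂ℓ)
  rw [abs_sub_comm, ← hd] at a1
  have a8 : 0 ≤ C * d := by positivity
  simp only [MixingRDS.markov]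
  linarith

end Observables

/-! ### Trajectories -/

section Trajectories

variable {H E Ω : Type*} [MeasurableSpace Ω] {P : Measure Ω} {S : H × E → H} {X : Set H}
  {K : Set E}

theorem traj_congr (u : H) {ζ ζ' : ℕ → E} {m : ℕ} (h : ∀ i < m, ζ i = ζ' i) :
    traj S u ζ m = traj S u ζ' m := by
  induction m with
  | zero => rfl
  | succ m ih => rw [traj, traj, ih fun i hi => h i (by omega), h m (by omega)]

theorem traj_mem (hinv : ∀ u ∈ X, ∀ z ∈ K, S (u, z) ∈ X) {u : H} (hu : u ∈ X) {ζ : ℕ → E}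
    (hζ : ∀ i, ζ i ∈ K) (m : ℕ) : traj S u ζ m ∈ X := by
  induction m with
  | zero => exact hu
  | succ m ih => exact hinv _ ih _ (hζ m)

theorem continuous_traj [TopologicalSpace H] [TopologicalSpace E] (hS : Continuous S) (m : ℕ) :
    Continuous fun p : H × (ℕ → E) => traj S p.1 p.2 m := by
  induction m with
  | zero => exact continuous_fst
  | succ m ih => exact hS.comp (ih.prodMk ((continuous_apply m).comp continuous_snd))

theorem measurable_traj [MeasurableSpace H] [MeasurableSpace E] (hS : Measurable S) (m : ℕ) :
    Measurable fun p : H × (ℕ → E) => traj S p.1 p.2 m := by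
  induction m with
  | zero => exact measurable_fst
  | succ m ih => exact hS.comp (ih.prodMk ((measurable_pi_apply m).comp measurable_snd))

variable [MeasurableSpace E] {η : ℕ → Ω → E}

theorem measurable_traj_noise [MeasurableSpace H] (hS : Measurable S) (hη : ∀ k, Measurable (η k))
    (u : H) (m : ℕ) : Measurable fun ω => traj S u (fun i => η i ω) m :=
  (measurable_traj hS m).comp (measurable_const.prodMk (measurable_pi_lambda _ hη))

/-- The state at time `m` is a function `φ` of the noises with index below `m` only; the later ones
are filled in by an arbitrary point. -/
theorem indepFun_traj [MeasurableSpace H] [Nonempty E] (hS : Measurable S)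
    (hη : ∀ k, Measurable (η k)) (hind : iIndepFun η P) (u : H) (m : ℕ) :
    IndepFun (fun ω => traj S u (fun i => η i ω) m) (η m) P := by
  let z₀ : E := Classical.arbitrary E
  have h := hind.indepFun_finset (Finset.range m) {m} (by simp) hη
  let φ : (Finset.range m → E) → H := fun x =>
    traj S u (fun i => if hi : i ∈ Finset.range m then x ⟨i, hi⟩ else z₀) m
  have hφ : Measurable φ := by
    refine (measurable_traj hS m).comp (measurable_const.prodMk (measurable_pi_lambda _ fun i => ?_))
    change Measurable fun x : Finset.range m → E =>
      if hi : i ∈ Finset.range m then x ⟨i, hi⟩ else z₀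
    split_ifs with hi
    · exact measurable_pi_apply (⟨i, hi⟩ : Finset.range m)
    · exact measurable_const
  have hm : Measurable fun x : ({m} : Finset ℕ) → E => x ⟨m, by simp⟩ := measurable_pi_apply _
  have h2 := h.comp hφ hm
  refine h2.congr (Eventually.of_forall fun ω => ?_) (Eventually.of_forall fun ω => rfl)
  refine traj_congr u fun i hi => ?_
  simp [hi]

/-- The Markov property: the last noise is integrated out first, which replaces `g` by `markov g`;
hence the induction is over all `g`. -/
theorem integral_traj_eq_markov_iterate [NormedAddCommGroup H] [MeasurableSpace H] [BorelSpace H]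
    [NormedAddCommGroup E] [BorelSpace E] [SecondCountableTopologyEither H E]
    [IsProbabilityMeasure P] (hS : Continuous S) (hη : ∀ k, Measurable (η k))
    (hind : iIndepFun η P) (hid : ∀ k, IdentDistrib (η k) (η 0) P P) (u : H) (m : ℕ) {g : H → ℝ}
    (hg : IsUnitValued g) :
    ∫ ω, g (traj S u (fun i => η i ω) m) ∂P = (markov (P.map (η 0)) S)^[m] g u := by
  have : IsProbabilityMeasure (P.map (η 0)) := Measure.isProbabilityMeasure_map (hη 0).aemeasurable
  induction m generalizing g with
  | zero => simp [traj]
  | succ m ih =>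
    have hT := measurable_traj_noise hS.measurable hη u m
    have hSm := hS.measurable
    rw [Function.iterate_succ_apply, ← ih (hg.markov hSm)]
    have hmap := (indepFun_iff_map_prod_eq_prod_map_map hT.aemeasurable (hη m).aemeasurable).1
      (indepFun_traj hS.measurable hη hind u m)
    rw [(hid m).map_eq] at hmap
    have : IsProbabilityMeasure (P.map fun ω => traj S u (fun i => η i ω) m) :=
      Measure.isProbabilityMeasure_map hT.aemeasurable
    have hgS : Measurable fun p : H × E => g (S p) := hg.measurable.comp hSm
    calc ∫ ω, g (traj S u (fun i => η i ω) (m + 1)) ∂P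
        = ∫ p, g (S p) ∂(P.map fun ω => (traj S u (fun i => η i ω) m, η m ω)) := by
          rw [integral_map (hT.prodMk (hη m)).aemeasurable hgS.aestronglyMeasurable]
          rfl
      _ = ∫ x, markov (P.map (η 0)) S g x ∂(P.map fun ω => traj S u (fun i => η i ω) m) := by
          rw [hmap, integral_prod _ (hg.integrable hSm)]
          rfl
      _ = _ := integral_map hT.aemeasurable (hg.markov hSm).measurable.aestronglyMeasurable

/-- From every point of `X` the trajectories reach a given neighbourhood of `p` at time `m` with a
probability bounded away from zero. -/
theorem exists_reach_probability [NormedAddCommGroup H] [NormedAddCommGroup E]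
    [BorelSpace E] [IsProbabilityMeasure P] (hS : Continuous S) (hη : ∀ k, Measurable (η k))
    (hind : iIndepFun η P) (hid : ∀ k, IdentDistrib (η k) (η 0) P P) (hX : IsCompact X)
    {p : H} {ε : ℝ} {m : ℕ} (hm : 1 ≤ m)
    (h : ∀ u ∈ X, ∃ ζ : ℕ → E, (∀ i < m, ζ i ∈ (P.map (η 0)).support) ∧ ‖traj S u ζ m - p‖ < ε) :
    ∃ δ : ℝ, 0 < δ ∧ ∀ u ∈ X, δ ≤ P.real {ω | ‖traj S u (fun i => η i ω) m - p‖ < ε} := by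
  refine hX.induction_on (p := fun s => ∃ δ : ℝ, 0 < δ ∧ ∀ u ∈ s,
    δ ≤ P.real {ω | ‖traj S u (fun i => η i ω) m - p‖ < ε}) ⟨1, one_pos, by simp⟩ ?_ ?_ ?_
  · rintro s t hst ⟨δ, hδ, h⟩
    exact ⟨δ, hδ, fun u hu => h u (hst hu)⟩
  · rintro s t ⟨δ, hδ, h⟩ ⟨δ', hδ', h'⟩
    refine ⟨min δ δ', lt_min hδ hδ', ?_⟩
    rintro u (hu | hu)
    · exact (min_le_left _ _).trans (h u hu)
    · exact (min_le_right _ _).trans (h' u hu)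
  intro u₀ hu₀
  obtain ⟨ζ, hζ, hζε⟩ := h u₀ hu₀
  -- A basic neighbourhood in the product may constrain coordinates beyond `m`, so every coordinate
  -- of the control has to lie in the support; `1 ≤ m` makes `ζ 0` available as filler.
  let ζ' : ℕ → E := fun i => if i < m then ζ i else ζ 0
  have hζ' : ∀ i, ζ' i ∈ (P.map (η 0)).support := fun i => by
    by_cases hi : i < m
    · simpa [ζ', hi] using hζ i hi
    · simpa [ζ', hi] using hζ 0 hm
  have hζε' : ‖traj S u₀ ζ' m - p‖ < ε := by
    rwa [traj_congr u₀ (ζ' := ζ) fun i hi => by simp [ζ', hi]]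
  have hopen : IsOpen {q : H × (ℕ → E) | ‖traj S q.1 q.2 m - p‖ < ε} :=
    isOpen_lt (((continuous_traj hS m).sub continuous_const).norm) continuous_const
  obtain ⟨W, hW, Z, hZ, hWZ⟩ := mem_nhds_prod_iff.1
    (hopen.mem_nhds (show (u₀, ζ') ∈ _ from hζε'))
  rw [nhds_pi, Filter.mem_pi'] at hZ
  obtain ⟨I, t, ht, htZ⟩ := hZ
  choose V hVt hVo hVζ using fun i => mem_nhds_iff.1 (ht i)
  have hpos : ∀ i, 0 < P.real (η i ⁻¹' V i) := by
    intro i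
    have h1 : 0 < P.map (η i) (V i) := by
      rw [(hid i).map_eq]
      exact (Measure.mem_support_iff_forall _).1 (hζ' i) _ ((hVo i).mem_nhds (hVζ i))
    rw [Measure.map_apply (hη i) (hVo i).measurableSet] at h1
    exact ENNReal.toReal_pos h1.ne' (measure_ne_top _ _)
  refine ⟨W, mem_nhdsWithin_of_mem_nhds hW, ∏ i ∈ I, P.real (η i ⁻¹' V i),
    Finset.prod_pos fun i _ => hpos i, fun u hu => ?_⟩
  have hI := hind.measure_inter_preimage_eq_mul I (sets := V) fun i _ => (hVo i).measurableSet
  have e1 : ∏ i ∈ I, P.real (η i ⁻¹' V i) = P.real (⋂ i ∈ I, η i ⁻¹' V i) := by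
    rw [Measure.real, hI, ENNReal.toReal_prod]
    rfl
  rw [e1]
  refine measureReal_mono (fun ω hω => ?_)
  have : (u, fun i => η i ω) ∈ W ×ˢ Z :=
    ⟨hu, htZ fun i hi => hVt i (Set.mem_iInter₂.1 hω i hi)⟩
  exact hWZ this

end Trajectories

/-! ### Confinement of trajectories and the transition function -/

section Confinement

variable {H E Ω : Type*} [MeasurableSpace Ω] {P : Measure Ω} {η : ℕ → Ω → E}
  {S : H × E → H} {X : Set H} {K : Set E}

theorem ae_traj_mem (hη : ∀ᵐ ω ∂P, ∀ i, η i ω ∈ K) (hinv : ∀ u ∈ X, ∀ z ∈ K, S (u, z) ∈ X)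
    {u : H} (hu : u ∈ X) (m : ℕ) : ∀ᵐ ω ∂P, traj S u (fun i => η i ω) m ∈ X := by
  filter_upwards [hη] with ω hω
  exact traj_mem hinv hu hω m

theorem measurable_transition [MeasurableSpace H] [MeasurableSpace E] [SFinite P] (hS : Measurable S) (hη : ∀ k, Measurable (η k))
    (hX : MeasurableSet X) (k : ℕ) : Measurable (transition P S η X k) := by
  refine Measure.measurable_of_measurable_coe _ fun s hs => ?_
  have hs' : MeasurableSet (Subtype.val '' s : Set H) := hX.subtype_image hs
  have hJ : Measurable fun q : X × Ω => traj S (q.1 : H) (fun i => η i q.2) k :=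
    (measurable_traj hS k).comp ((measurable_subtype_coe.comp measurable_fst).prodMk
      (measurable_pi_lambda _ fun i => (hη i).comp measurable_snd))
  have e : ∀ u : X, transition P S η X k u s =
      P (Prod.mk u ⁻¹' ((fun q : X × Ω => traj S (q.1 : H) (fun i => η i q.2) k) ⁻¹'
        (Subtype.val '' s))) := by
    intro u
    rw [transition, (MeasurableEmbedding.subtype_coe hX).comap_apply,
      Measure.map_apply (measurable_traj_noise hS hη _ k) hs']
    rfl
  simp_rw [e]
  exact measurable_measure_prodMk_left (hJ hs')

/-- Restricting to `X` loses no mass, because trajectories issued from `X` almost surely stay there.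
-/
theorem map_val_transition [MeasurableSpace H] [MeasurableSpace E] (hS : Measurable S) (hη : ∀ k, Measurable (η k))
    (hX : MeasurableSet X) (hηK : ∀ᵐ ω ∂P, ∀ i, η i ω ∈ K)
    (hinv : ∀ u ∈ X, ∀ z ∈ K, S (u, z) ∈ X) (k : ℕ) (u : X) :
    (transition P S η X k u).map Subtype.val =
      P.map fun ω => traj S (u : H) (fun i => η i ω) k := by
  rw [transition, (MeasurableEmbedding.subtype_coe hX).map_comap, Subtype.range_coe,
    Measure.restrict_eq_self_of_ae_mem]
  exact (ae_map_iff (measurable_traj_noise hS hη _ k).aemeasurable hX).2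
    (ae_traj_mem hηK hinv u.2 k)

theorem isProbabilityMeasure_transition [MeasurableSpace H] [MeasurableSpace E]
    [IsProbabilityMeasure P] (hS : Measurable S) (hη : ∀ k, Measurable (η k))
    (hX : MeasurableSet X) (hηK : ∀ᵐ ω ∂P, ∀ i, η i ω ∈ K)
    (hinv : ∀ u ∈ X, ∀ z ∈ K, S (u, z) ∈ X) (k : ℕ) (u : X) :
    IsProbabilityMeasure (transition P S η X k u) := by
  constructor
  have h := congrArg (fun μ => μ Set.univ) (map_val_transition hS hη hX hηK hinv k u)
  have := Measure.isProbabilityMeasure_map (μ := P)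
    (measurable_traj_noise hS hη (u : H) k).aemeasurable
  rw [Measure.map_apply measurable_subtype_coe MeasurableSet.univ, measure_univ] at h
  exact h

theorem isProbabilityMeasure_dualOp [MeasurableSpace H] [MeasurableSpace E]
    [IsProbabilityMeasure P] (hS : Measurable S) (hη : ∀ k, Measurable (η k))
    (hX : MeasurableSet X) (hηK : ∀ᵐ ω ∂P, ∀ i, η i ω ∈ K)
    (hinv : ∀ u ∈ X, ∀ z ∈ K, S (u, z) ∈ X) (k : ℕ) (lam : ProbabilityMeasure X) :
    IsProbabilityMeasure (dualOp P S η X k (lam : Measure X)) :=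
  isProbabilityMeasure_bind (measurable_transition hS hη hX k).aemeasurable
    (Eventually.of_forall fun u => isProbabilityMeasure_transition hS hη hX hηK hinv k u)

end Confinement

/-! ### Decay of oscillations -/

section Oscillation

variable {H E Ω : Type*} [NormedAddCommGroup H] [MeasurableSpace H] [BorelSpace H]
  [NormedAddCommGroup E] [MeasurableSpace E] [BorelSpace E] [SecondCountableTopologyEither H E]
  [MeasurableSpace Ω] {P : Measure Ω} [IsProbabilityMeasure P] {η : ℕ → Ω → E}
  {S : H × E → H} {X : Set H} {K : Set E} {g : H → ℝ}

/-- The values of `g` on `X` lie in an interval of length `a`. -/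
def OscLE (X : Set H) (g : H → ℝ) (a : ℝ) : Prop :=
  ∃ c : ℝ, ∀ u ∈ X, g u ∈ Set.Icc c (c + a)

theorem markov_iterate_mem_Icc (hS : Continuous S) (hη : ∀ k, Measurable (η k))
    (hind : iIndepFun η P) (hid : ∀ k, IdentDistrib (η k) (η 0) P P)
    (hηK : ∀ᵐ ω ∂P, ∀ i, η i ω ∈ K) (hinv : ∀ u ∈ X, ∀ z ∈ K, S (u, z) ∈ X)
    (hg : IsUnitValued g) {a b : ℝ} (hab : ∀ u ∈ X, g u ∈ Set.Icc a b) (m : ℕ) {u : H}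
    (hu : u ∈ X) : (markov (P.map (η 0)) S)^[m] g u ∈ Set.Icc a b := by
  rw [← integral_traj_eq_markov_iterate hS hη hind hid u m hg]
  have hT := measurable_traj_noise hS.measurable hη u m
  have hi := hg.integrable (μ := P) hT
  have hX := ae_traj_mem (P := P) hηK hinv hu m
  constructor
  · have := integral_mono_ae (integrable_const a) hi (hX.mono fun ω h => (hab _ h).1)
    simpa using this
  · have := integral_mono_ae hi (integrable_const b) (hX.mono fun ω h => (hab _ h).2)
    simpa using this

theorem OscLE.markov_iterate (hS : Continuous S) (hη : ∀ k, Measurable (η k))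
    (hind : iIndepFun η P) (hid : ∀ k, IdentDistrib (η k) (η 0) P P)
    (hηK : ∀ᵐ ω ∂P, ∀ i, η i ω ∈ K) (hinv : ∀ u ∈ X, ∀ z ∈ K, S (u, z) ∈ X)
    (hg : IsUnitValued g) {a : ℝ} (h : OscLE X g a) (m : ℕ) :
    OscLE X ((markov (P.map (η 0)) S)^[m] g) a := by
  obtain ⟨c, hc⟩ := h
  exact ⟨c, fun u hu => markov_iterate_mem_Icc hS hη hind hid hηK hinv hg hc m hu⟩

/-- If `g` is close to its value at `p` in the `ε`-neighbourhood of `p`, and this neighbourhood is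
reached at time `m` with probability at least `δ`, then the oscillation contracts. -/
theorem OscLE.contract (hS : Continuous S) (hη : ∀ k, Measurable (η k))
    (hind : iIndepFun η P) (hid : ∀ k, IdentDistrib (η k) (η 0) P P)
    (hηK : ∀ᵐ ω ∂P, ∀ i, η i ω ∈ K) (hinv : ∀ u ∈ X, ∀ z ∈ K, S (u, z) ∈ X)
    (hg : IsUnitValued g) {a : ℝ} (ha : 0 ≤ a) (h : OscLE X g a) {p : H} {ε δ : ℝ} {m : ℕ}
    (hgp : ∀ u ∈ X, ‖u - p‖ < ε → |g u - g p| ≤ a / 4)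
    (hδ : ∀ u ∈ X, δ ≤ P.real {ω | ‖traj S u (fun i => η i ω) m - p‖ < ε}) :
    OscLE X ((markov (P.map (η 0)) S)^[m] g) ((1 - δ / 4) * a) := by
  obtain ⟨c, hc⟩ := h
  have hit : ∀ u, (markov (P.map (η 0)) S)^[m] g u =
      ∫ ω, g (traj S u (fun i => η i ω) m) ∂P := fun u =>
    (integral_traj_eq_markov_iterate hS hη hind hid u m hg).symm
  have hA : ∀ u, MeasurableSet {ω | ‖traj S u (fun i => η i ω) m - p‖ < ε} := fun u =>
    (isOpen_lt ((continuous_id.sub continuous_const).norm) continuous_const).measurableSet.preimage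
      (measurable_traj_noise hS.measurable hη u m)
  have hi : ∀ u, Integrable (fun ω => g (traj S u (fun i => η i ω) m)) P := fun u =>
    hg.integrable (measurable_traj_noise hS.measurable hη u m)
  have hI : ∀ u (s : ℝ), Integrable (fun ω =>
      s * {ω | ‖traj S u (fun i => η i ω) m - p‖ < ε}.indicator (fun _ => (1 : ℝ)) ω) P :=
    fun u s => ((integrable_const _).indicator (hA u)).const_mul s
  have hII : ∀ u (s t : ℝ), ∫ ω,
      (t + s * {ω | ‖traj S u (fun i => η i ω) m - p‖ < ε}.indicator (fun _ => (1 : ℝ)) ω) ∂P =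
      t + s * P.real {ω | ‖traj S u (fun i => η i ω) m - p‖ < ε} := by
    intro u s t
    have e1 : ∫ ω, {ω | ‖traj S u (fun i => η i ω) m - p‖ < ε}.indicator (fun _ => (1 : ℝ)) ω ∂P =
        P.real {ω | ‖traj S u (fun i => η i ω) m - p‖ < ε} := integral_indicator_one (hA u)
    rw [integral_add (integrable_const _) (hI u s), integral_const_mul s, e1]
    simp
  have hXu : ∀ u ∈ X, ∀ᵐ ω ∂P, traj S u (fun i => η i ω) m ∈ X := fun u hu =>
    ae_traj_mem hηK hinv hu m
  have hic : ∀ u ∈ X, (markov (P.map (η 0)) S)^[m] g u ∈ Set.Icc c (c + a) := fun u hu =>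
    markov_iterate_mem_Icc hS hη hind hid hηK hinv hg hc m hu
  -- If `g p` is in the lower half of the interval, then `g ≤ c + 3a/4` near `p`, and an event of
  -- probability at least `δ` lowers the upper end by `δ a / 4`; otherwise the lower end rises by as
  -- much.
  rcases le_total (g p) (c + a / 2) with hp | hp
  · refine ⟨c, fun u hu => ⟨(hic u hu).1, ?_⟩⟩
    have hle : ∀ᵐ ω ∂P, g (traj S u (fun i => η i ω) m) ≤ (c + a) + (-(a / 4)) *
        {ω | ‖traj S u (fun i => η i ω) m - p‖ < ε}.indicator (fun _ => (1 : ℝ)) ω := by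
      filter_upwards [hXu u hu] with ω hω
      by_cases hω' : ‖traj S u (fun i => η i ω) m - p‖ < ε
      · rw [Set.indicator_of_mem (by exact hω')]
        linarith [(abs_le.1 (hgp _ hω hω')).2]
      · rw [Set.indicator_of_notMem (by exact hω')]
        linarith [(hc _ hω).2]
    have := integral_mono_ae (hi u) ((integrable_const (c + a)).add (hI u (-(a / 4)))) hle
    rw [← hit] at this
    have h2 := this.trans_eq (hII u (-(a / 4)) (c + a))
    nlinarith [mul_le_mul_of_nonneg_left (hδ u hu) (by positivity : 0 ≤ a / 4)]
  · refine ⟨c + δ / 4 * a, fun u hu => ⟨?_, ?_⟩⟩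
    · have hle : ∀ᵐ ω ∂P, c + (a / 4) *
          {ω | ‖traj S u (fun i => η i ω) m - p‖ < ε}.indicator (fun _ => (1 : ℝ)) ω ≤
          g (traj S u (fun i => η i ω) m) := by
        filter_upwards [hXu u hu] with ω hω
        by_cases hω' : ‖traj S u (fun i => η i ω) m - p‖ < ε
        · rw [Set.indicator_of_mem (by exact hω')]
          linarith [(abs_le.1 (hgp _ hω hω')).1]
        · rw [Set.indicator_of_notMem (by exact hω')]
          linarith [(hc _ hω).1]
      have := integral_mono_ae ((integrable_const c).add (hI u (a / 4))) (hi u) hle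
      rw [← hit] at this
      have h2 := (hII u (a / 4) c).symm.trans_le this
      nlinarith [mul_le_mul_of_nonneg_left (hδ u hu) (by positivity : 0 ≤ a / 4)]
    · have := (hic u hu).2
      linarith

/-- If the Markov operator preserves the `L`-Lipschitz observables and every neighbourhood of `p`
is reached uniformly, then oscillations decay uniformly over the `L`-Lipschitz observables. -/
theorem exists_oscLE_iterate (hS : Continuous S) (hη : ∀ k, Measurable (η k))
    (hind : iIndepFun η P) (hid : ∀ k, IdentDistrib (η k) (η 0) P P)
    (hηK : ∀ᵐ ω ∂P, ∀ i, η i ω ∈ K) (hinv : ∀ u ∈ X, ∀ z ∈ K, S (u, z) ∈ X)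
    {L : ℝ} (hL : 0 < L)
    (hobs : ∀ g, IsObservable X L g → IsObservable X L (markov (P.map (η 0)) S g)) {p : H}
    (hp : p ∈ X) (hreach : ∀ ε : ℝ, 0 < ε → ∃ (m : ℕ) (δ : ℝ), 0 < δ ∧
      ∀ u ∈ X, δ ≤ P.real {ω | ‖traj S u (fun i => η i ω) m - p‖ < ε}) {a : ℝ} (ha : 0 < a) :
    ∃ N : ℕ, ∀ k, N ≤ k → ∀ g, IsObservable X L g →
      OscLE X ((markov (P.map (η 0)) S)^[k] g) a := by
  have hobs' : ∀ k g, IsObservable X L g →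
      IsObservable X L ((markov (P.map (η 0)) S)^[k] g) := by
    intro k
    induction k with
    | zero => exact fun g hg => hg
    | succ k ih => exact fun g hg => ih _ (hobs g hg)
  -- On this ball every `L`-Lipschitz function varies from its value at `p` by at most `a/4`, so `m`
  -- and `δ` serve all observables and all their iterates.
  obtain ⟨m, δ, hδ, hr⟩ := hreach (a / (4 * L)) (by positivity)
  have hδ1 : δ ≤ 1 := (hr p hp).trans measureReal_le_one
  have hr0 : 0 ≤ 1 - δ / 4 := by linarith
  have hr1 : 1 - δ / 4 < 1 := by linarith
  -- The floor `a` is needed because the contraction step requires variation near `p` below a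
  -- quarter of the current oscillation bound.
  have hstep : ∀ n g, IsObservable X L g →
      OscLE X ((markov (P.map (η 0)) S)^[m * n] g) (max a ((1 - δ / 4) ^ n)) := by
    intro n g hg
    induction n with
    | zero =>
      refine ⟨0, fun u _ => ⟨(hg.mem_Icc u).1, (hg.mem_Icc u).2.trans ?_⟩⟩
      simp
    | succ n ih =>
      have ho := hobs' (m * n) g hg
      obtain ⟨c, hc⟩ := OscLE.contract hS hη hind hid hηK hinv ho.toIsUnitValued
        (ha.le.trans (le_max_left _ _)) ih (p := p) (ε := a / (4 * L)) (fun u hu hup => by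
          refine (ho.lipschitz u hu p hp).trans ?_
          have h1 : L * ‖u - p‖ ≤ L * (a / (4 * L)) := by gcongr
          have h2 : L * (a / (4 * L)) = a / 4 := by field_simp
          have h3 := le_max_left a ((1 - δ / 4) ^ n)
          linarith) hr
      rw [← Function.iterate_add_apply, show m + m * n = m * (n + 1) by ring] at hc
      refine ⟨c, fun u hu => ⟨(hc u hu).1, (hc u hu).2.trans ?_⟩⟩
      rw [mul_max_of_nonneg _ _ hr0, pow_succ']
      gcongr
      exact mul_le_of_le_one_left ha.le hr1.le
  obtain ⟨n, hn⟩ := exists_pow_lt_of_lt_one ha hr1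
  refine ⟨m * n, fun k hk g hg => ?_⟩
  have h1 := hstep n g hg
  rw [max_eq_left hn.le] at h1
  have h2 := h1.markov_iterate hS hη hind hid hηK hinv (hobs' _ g hg).toIsUnitValued (k - m * n)
  rwa [← Function.iterate_add_apply, Nat.sub_add_cancel hk] at h2

end Oscillation

/-! ### The dual semigroup -/

section Dual

variable {H E Ω : Type*} [NormedAddCommGroup H] [MeasurableSpace H] [BorelSpace H]
  [NormedAddCommGroup E] [MeasurableSpace E] [BorelSpace E] [SecondCountableTopologyEither H E]
  [MeasurableSpace Ω] {P : Measure Ω} [IsProbabilityMeasure P] {η : ℕ → Ω → E}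
  {S : H × E → H} {X : Set H} {K : Set E} {g : H → ℝ}

theorem integral_bind_eq {α β : Type*} [MeasurableSpace α] [MeasurableSpace β] {m : Measure α}
    {μ : α → Measure β} (hμ : Measurable μ) {f : β → ℝ} (hf : Integrable f (m.bind μ)) :
    ∫ y, f y ∂(m.bind μ) = ∫ x, ∫ y, f y ∂(μ x) ∂m := by
  have key : ∀ κ : Kernel α β, Integrable f (m.bind κ) →
      ∫ y, f y ∂(m.bind κ) = ∫ x, ∫ y, f y ∂(κ x) ∂m := by
    intro κ hκ
    rw [Measure.comp_eq_comp_const_apply] at hκ ⊢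
    rw [Kernel.integral_comp hκ, Kernel.const_apply]
  exact key ⟨μ, hμ⟩ hf

theorem integral_dualOp (hS : Continuous S) (hη : ∀ k, Measurable (η k))
    (hind : iIndepFun η P) (hid : ∀ k, IdentDistrib (η k) (η 0) P P)
    (hX : MeasurableSet X) (hηK : ∀ᵐ ω ∂P, ∀ i, η i ω ∈ K)
    (hinv : ∀ u ∈ X, ∀ z ∈ K, S (u, z) ∈ X) (k : ℕ) (lam : ProbabilityMeasure X)
    (hg : IsUnitValued g) :
    ∫ u, g (u : H) ∂(dualOp P S η X k (lam : Measure X)) =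
      ∫ u, (markov (P.map (η 0)) S)^[k] g (u : H) ∂(lam : Measure X) := by
  have hSm := hS.measurable
  have : IsProbabilityMeasure ((lam : Measure X).bind (transition P S η X k)) :=
    isProbabilityMeasure_dualOp hSm hη hX hηK hinv k lam
  have hu : ∀ u : X, ∫ x, g (x : H) ∂(transition P S η X k u) =
      (markov (P.map (η 0)) S)^[k] g (u : H) := by
    intro u
    have hT := measurable_traj_noise hSm hη (u : H) k
    rw [← integral_traj_eq_markov_iterate hS hη hind hid u k hg,
      ← integral_map (φ := fun ω => traj S (u : H) (fun i => η i ω) k) hT.aemeasurable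
        hg.measurable.aestronglyMeasurable,
      ← map_val_transition hSm hη hX hηK hinv k u,
      integral_map measurable_subtype_coe.aemeasurable hg.measurable.aestronglyMeasurable]
  simp_rw [← hu]
  exact integral_bind_eq (measurable_transition hSm hη hX k) (hg.integrable measurable_subtype_coe)

end Dual

/-! ### Lipschitz observables determine measures and control the dual-Lipschitz distance -/

section LipNorm

variable {Y : Type*} [MetricSpace Y] {f : Y → ℝ}

theorem abs_le_one_of_lipNorm_le_one (hf : lipNorm f ≤ 1) (u : Y) : |f u| ≤ 1 := by
  have h1 : ‖f u‖ₑ ≤ 1 := (le_iSup (fun u => ‖f u‖ₑ) u).trans (le_self_add.trans hf)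
  rw [← Real.norm_eq_abs, ← toReal_enorm]
  exact ENNReal.toReal_le_of_le_ofReal zero_le_one (by simpa using h1)

/-- The norm only compares points at distance at most `1`; for the others `|f u - f v| ≤ 2` is used,
whence the factor `2`. -/
theorem abs_sub_le_of_lipNorm_le_one (hf : lipNorm f ≤ 1) (u v : Y) : |f u - f v| ≤ 2 * dist u v := by
  rcases eq_or_ne u v with rfl | huv
  · simp
  have hd := dist_pos.2 huv
  rcases le_total (dist u v) 1 with h1 | h1
  · have h2 : ‖f u - f v‖ₑ / edist u v ≤ 1 := by
      refine le_trans ?_ (le_add_self.trans hf)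
      exact le_iSup_of_le u (le_iSup_of_le v (le_iSup_of_le ⟨hd, h1⟩ le_rfl))
    have h3 : ‖f u - f v‖ₑ ≤ edist u v := by
      rwa [ENNReal.div_le_iff (edist_pos.2 huv).ne' (edist_ne_top _ _), one_mul] at h2
    have h4 : |f u - f v| ≤ dist u v := by
      rw [edist_dist] at h3
      rw [← Real.norm_eq_abs, ← toReal_enorm]
      exact ENNReal.toReal_le_of_le_ofReal hd.le h3
    linarith
  · have := abs_sub (f u) (f v)
    have h2 := abs_le_one_of_lipNorm_le_one hf u
    have h3 := abs_le_one_of_lipNorm_le_one hf v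
    linarith

end LipNorm

section TestFunctions

variable {H : Type*} [NormedAddCommGroup H] [MeasurableSpace H] {X : Set H}

theorem IsObservable.continuous_restrict {L : ℝ} {g : H → ℝ} (hL : 0 ≤ L)
    (hg : IsObservable X L g) : Continuous fun u : X => g u :=
  (LipschitzWith.of_dist_le_mul (K := L.toNNReal) fun u v => by
    rw [Real.dist_eq, Real.coe_toNNReal _ hL, Subtype.dist_eq, dist_eq_norm]
    exact hg.lipschitz u u.2 v v.2).continuous

variable [BorelSpace H]

/-- Extension by zero is harmless: observables need be Lipschitz on `X` only, and measurable on `H`.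
-/
theorem isObservable_extend (hX : MeasurableSet X) {f : X → ℝ} {L : ℝ} (hL : 0 ≤ L)
    (hf : ∀ u, f u ∈ Set.Icc (0 : ℝ) 1) (hl : ∀ u v, |f u - f v| ≤ L * dist u v) :
    IsObservable X L (Function.extend Subtype.val f 0) := by
  have hinj : Function.Injective (Subtype.val : X → H) := Subtype.val_injective
  have hc : Continuous f :=
    (LipschitzWith.of_dist_le_mul (K := L.toNNReal) fun u v => by
      rw [Real.dist_eq, Real.coe_toNNReal _ hL]; exact hl u v).continuous
  refine ⟨⟨(MeasurableEmbedding.subtype_coe hX).measurable_extend hc.measurable measurable_zero,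
    fun u => ?_⟩, fun u hu v hv => ?_⟩
  · by_cases hu : u ∈ X
    · have := hinj.extend_apply f 0 ⟨u, hu⟩
      rw [this]
      exact hf _
    · rw [Function.extend_apply' _ _ _ (by simpa using hu)]
      simp
  · have h1 := hinj.extend_apply f 0 ⟨u, hu⟩
    have h2 := hinj.extend_apply f 0 ⟨v, hv⟩
    rw [h1, h2, ← dist_eq_norm]
    exact hl _ _

/-- Bounded Lipschitz functions, rescaled affinely into `[0,1]`, determine weak limits; this is
applied to a constant sequence. A lower bound on `L` costs nothing, since the classes grow with `L`.
-/
theorem eq_of_forall_observable [Nonempty X] (hX : MeasurableSet X) {L₀ : ℝ}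
    {μ ν : ProbabilityMeasure X}
    (h : ∀ L, L₀ ≤ L → ∀ g, IsObservable X L g →
      ∫ u, g (u : H) ∂(μ : Measure X) = ∫ u, g (u : H) ∂(ν : Measure X)) : μ = ν := by
  have hlim : Tendsto (fun _ : ℕ => μ) atTop (𝓝 ν) := by
    rw [tendsto_iff_forall_lipschitz_integral_tendsto]
    rintro f ⟨C, hC⟩ ⟨M, hM⟩
    suffices he : ∫ u, f u ∂(μ : Measure X) = ∫ u, f u ∂(ν : Measure X) by
      rw [he]; exact tendsto_const_nhds
    obtain ⟨x₀⟩ := ‹Nonempty X›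
    have hC0 : 0 ≤ C := dist_nonneg.trans (hC x₀ x₀)
    set D : ℝ := 2 * C + 1 with hD
    have hD0 : 0 < D := by positivity
    let f' : X → ℝ := fun u => (f u - f x₀ + C) / D
    have hf' : ∀ u, f' u ∈ Set.Icc (0 : ℝ) 1 := fun u => by
      have := abs_le.1 (hC u x₀)
      refine ⟨div_nonneg (by linarith [this.1]) hD0.le, ?_⟩
      rw [div_le_one hD0]
      linarith [this.2]
    have hl : ∀ u v, |f' u - f' v| ≤ max L₀ (M / D) * dist u v := fun u v => by
      have h1 : f' u - f' v = (f u - f v) / D := by simp only [f']; ring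
      rw [h1, abs_div, abs_of_pos hD0, div_le_iff₀ hD0]
      have h2 := hM.dist_le_mul u v
      rw [Real.dist_eq] at h2
      have h3 : M / D * dist u v * D = M * dist u v := by field_simp
      have h4 : M / D * dist u v * D ≤ max L₀ (M / D) * dist u v * D := by
        gcongr; exact le_max_right _ _
      linarith
    have hobs := isObservable_extend hX (L := max L₀ (M / D))
      (le_max_of_le_right (by positivity)) hf' hl
    have key := h _ (le_max_left _ _) _ hobs
    simp_rw [Subtype.val_injective.extend_apply] at key
    have hfe : ∀ u, f u = D * f' u + (f x₀ - C) := fun u => by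
      simp only [f']; field_simp; ring
    have hint : ∀ (ρ : ProbabilityMeasure X), Integrable f' (ρ : Measure X) := fun ρ => by
      have := hobs.toIsUnitValued.integrable (μ := (ρ : Measure X)) measurable_subtype_coe
      simpa only [Subtype.val_injective.extend_apply] using this
    have hI : ∀ ρ : ProbabilityMeasure X,
        ∫ u, f u ∂(ρ : Measure X) = D * ∫ u, f' u ∂(ρ : Measure X) + (f x₀ - C) := fun ρ => by
      rw [integral_congr_ae (Eventually.of_forall hfe),
        integral_add ((hint ρ).const_mul D) (integrable_const _), integral_const_mul]
      simp
    rw [hI μ, hI ν, key]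
  exact tendsto_nhds_unique tendsto_const_nhds hlim

/-- A test function `f` is replaced by `(f + 1) / 2`, which is `[0,1]`-valued and `1`-Lipschitz;
undoing this doubles the bound. -/
theorem dualLip_le_of_forall_observable (hX : MeasurableSet X) {L a : ℝ} (hL : 1 ≤ L)
    {μ ν : Measure X} [IsProbabilityMeasure μ] [IsProbabilityMeasure ν]
    (h : ∀ g, IsObservable X L g →
      |(∫ u, g (u : H) ∂μ) - ∫ u, g (u : H) ∂ν| ≤ a) :
    dualLip μ ν ≤ ENNReal.ofReal (2 * a) := by
  refine iSup₂_le fun f hf => ?_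
  let f' : X → ℝ := fun u => (f u + 1) / 2
  have hf' : ∀ u, f' u ∈ Set.Icc (0 : ℝ) 1 := fun u => by
    have := abs_le.1 (abs_le_one_of_lipNorm_le_one hf u)
    constructor <;> simp only [f'] <;> linarith [this.1, this.2]
  have hl : ∀ u v, |f' u - f' v| ≤ L * dist u v := fun u v => by
    have h1 : f' u - f' v = (f u - f v) / 2 := by simp only [f']; ring
    rw [h1, abs_div, abs_two]
    have h2 := abs_sub_le_of_lipNorm_le_one hf u v
    have h3 : dist u v ≤ L * dist u v := le_mul_of_one_le_left dist_nonneg hL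
    linarith
  have hobs := isObservable_extend hX (by linarith) hf' hl
  have key := h _ hobs
  simp_rw [Subtype.val_injective.extend_apply] at key
  have hint : ∀ (ρ : Measure X) [IsProbabilityMeasure ρ], Integrable f' ρ := fun ρ _ => by
    have := hobs.toIsUnitValued.integrable (μ := ρ) measurable_subtype_coe
    simpa only [Subtype.val_injective.extend_apply] using this
  have hfe : ∀ u, f u = 2 * f' u + (-1) := fun u => by simp only [f']; ring
  have hI : ∀ (ρ : Measure X) [IsProbabilityMeasure ρ], ∫ u, f u ∂ρ = 2 * ∫ u, f' u ∂ρ + (-1) := by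
    intro ρ _
    rw [integral_congr_ae (Eventually.of_forall hfe), integral_add ((hint ρ).const_mul 2) (integrable_const _), integral_const_mul]
    simp
  rw [hI μ, hI ν, ← ofReal_norm, Real.norm_eq_abs]
  refine ENNReal.ofReal_le_ofReal ?_
  rw [add_sub_add_right_eq_sub, ← mul_sub, abs_mul, abs_two]
  gcongr

end TestFunctions

/-! ### From decay of oscillations to mixing -/

section Mixing

variable {H E Ω : Type*} [NormedAddCommGroup H] [MeasurableSpace H] [BorelSpace H]
  [NormedAddCommGroup E] [MeasurableSpace E] [BorelSpace E] [SecondCountableTopologyEither H E]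
  [MeasurableSpace Ω] {P : Measure Ω} [IsProbabilityMeasure P] {η : ℕ → Ω → E}
  {S : H × E → H} {X : Set H} {K : Set E}

/-- Once `P^k g` takes values on `X` in an interval of length `a`, the integrals of `g` at all times
from `k` on, for every initial law, lie in that same interval. So does the integral against any weak
limit point `μ` of one orbit. Compactness of the space of probability measures supplies `μ`, chosen
before `g`, `L` and `a`. -/
theorem exists_mixing_measure (hS : Continuous S) (hη : ∀ k, Measurable (η k))
    (hind : iIndepFun η P) (hid : ∀ k, IdentDistrib (η k) (η 0) P P) (hX : IsCompact X)
    [Nonempty X] (hηK : ∀ᵐ ω ∂P, ∀ i, η i ω ∈ K) (hinv : ∀ u ∈ X, ∀ z ∈ K, S (u, z) ∈ X)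
    {L₀ : ℝ} (hL₀ : 1 ≤ L₀)
    (hosc : ∀ L, L₀ ≤ L → ∀ a : ℝ, 0 < a → ∃ N : ℕ, ∀ k, N ≤ k → ∀ g, IsObservable X L g →
      OscLE X ((markov (P.map (η 0)) S)^[k] g) a) :
    ∃ μ : ProbabilityMeasure X, ∀ L, L₀ ≤ L → ∀ a : ℝ, 0 < a → ∃ N : ℕ, ∀ k, N ≤ k →
      ∀ g, IsObservable X L g → ∀ lam : ProbabilityMeasure X,
      |(∫ u, g (u : H) ∂(dualOp P S η X k (lam : Measure X))) -
        ∫ u, g (u : H) ∂(μ : Measure X)| ≤ a := by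
  have hXm : MeasurableSet X := hX.measurableSet
  have : CompactSpace X := isCompact_iff_compactSpace.1 hX
  have hSm := hS.measurable
  obtain ⟨x₀⟩ := ‹Nonempty X›
  let lam₀ : ProbabilityMeasure X := ⟨Measure.dirac x₀, inferInstance⟩
  let μs : ℕ → ProbabilityMeasure X := fun k => ⟨dualOp P S η X k (lam₀ : Measure X),
    isProbabilityMeasure_dualOp hSm hη hXm hηK hinv k lam₀⟩
  let 𝒰 : Ultrafilter ℕ := Ultrafilter.of atTop
  obtain ⟨μ, -, hμ⟩ := isCompact_univ.ultrafilter_le_nhds (𝒰.map μs) (by simp)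
  have hlim : Tendsto μs (𝒰 : Filter ℕ) (𝓝 μ) := hμ
  refine ⟨μ, fun L hL a ha => ?_⟩
  obtain ⟨N, hN⟩ := hosc L hL a ha
  refine ⟨N, fun k hk g hg lam => ?_⟩
  obtain ⟨c, hc⟩ := hN k hk g hg
  have := Measure.isProbabilityMeasure_map (μ := P) (hη 0).aemeasurable
  have hQ : ∀ j, IsUnitValued ((markov (P.map (η 0)) S)^[j] g) :=
    hg.toIsUnitValued.markov_iterate hSm
  have hmem : ∀ j, k ≤ j → ∀ ν : ProbabilityMeasure X,
      ∫ u, g (u : H) ∂(dualOp P S η X j (ν : Measure X)) ∈ Set.Icc c (c + a) := by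
    intro j hj ν
    rw [integral_dualOp hS hη hind hid hXm hηK hinv j ν hg.toIsUnitValued]
    have hj' : ∀ u : X, (markov (P.map (η 0)) S)^[j] g (u : H) ∈ Set.Icc c (c + a) := fun u => by
      have := markov_iterate_mem_Icc hS hη hind hid hηK hinv (hQ k) hc (j - k) u.2
      rwa [← Function.iterate_add_apply, Nat.sub_add_cancel hj] at this
    have hi := (hQ j).integrable (μ := (ν : Measure X)) measurable_subtype_coe
    constructor
    · simpa using integral_mono (integrable_const c) hi fun u => (hj' u).1
    · simpa using integral_mono hi (integrable_const (c + a)) fun u => (hj' u).2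
  let f : BoundedContinuousFunction X ℝ := BoundedContinuousFunction.mkOfCompact
    ⟨fun u => g u, hg.continuous_restrict (by linarith)⟩
  have hf := ProbabilityMeasure.tendsto_iff_forall_integral_tendsto.1 hlim f
  have hev : ∀ᶠ j in (𝒰 : Filter ℕ), ∫ u, f u ∂(μs j : Measure X) ∈ Set.Icc c (c + a) := by
    have : ∀ᶠ j in (atTop : Filter ℕ), ∫ u, f u ∂(μs j : Measure X) ∈ Set.Icc c (c + a) := by
      filter_upwards [eventually_ge_atTop k] with j hj
      exact hmem j hj lam₀
    exact this.filter_mono (Ultrafilter.of_le _)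
  have h1 := isClosed_Icc.mem_of_tendsto hf hev
  have h2 := hmem k le_rfl lam
  change ∫ u, g (u : H) ∂(μ : Measure X) ∈ Set.Icc c (c + a) at h1
  rw [abs_le]
  constructor <;> linarith [h1.1, h1.2, h2.1, h2.2]

end Mixing

/-! ### Stationary measures -/

section Stationary

variable {H E Ω : Type*} [NormedAddCommGroup H] [MeasurableSpace H] [BorelSpace H]
  [NormedAddCommGroup E] [MeasurableSpace E] [BorelSpace E] [SecondCountableTopologyEither H E]
  [MeasurableSpace Ω] {P : Measure Ω} [IsProbabilityMeasure P] {η : ℕ → Ω → E}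
  {S : H × E → H} {X : Set H} {K : Set E}

/-- A measure that attracts all Lipschitz observables, uniformly in the observable and in the initial
measure, is the unique stationary measure and attracts in the dual-Lipschitz distance. -/
theorem stationary_of_mixing (hS : Continuous S) (hη : ∀ k, Measurable (η k))
    (hind : iIndepFun η P) (hid : ∀ k, IdentDistrib (η k) (η 0) P P) (hXm : MeasurableSet X)
    [Nonempty X] (hηK : ∀ᵐ ω ∂P, ∀ i, η i ω ∈ K) (hinv : ∀ u ∈ X, ∀ z ∈ K, S (u, z) ∈ X)
    {L₀ : ℝ} (hL₀ : 1 ≤ L₀)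
    (hobs : ∀ L, L₀ ≤ L → ∀ g, IsObservable X L g → IsObservable X L (markov (P.map (η 0)) S g))
    {μ : ProbabilityMeasure X}
    (hμ : ∀ L, L₀ ≤ L → ∀ a : ℝ, 0 < a → ∃ N : ℕ, ∀ k, N ≤ k →
      ∀ g, IsObservable X L g → ∀ lam : ProbabilityMeasure X,
      |(∫ u, g (u : H) ∂(dualOp P S η X k (lam : Measure X))) -
        ∫ u, g (u : H) ∂(μ : Measure X)| ≤ a) :
    IsStationary P S η X μ ∧ (∀ ν : ProbabilityMeasure X, IsStationary P S η X ν → ν = μ) ∧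
      ∃ γ : ℕ → ℝ, (∀ k, 0 < γ k) ∧ Tendsto γ atTop (𝓝 0) ∧
        ∀ (k : ℕ) (lam : ProbabilityMeasure X),
          dualLip (dualOp P S η X k (lam : Measure X)) (μ : Measure X)
            ≤ ENNReal.ofReal (γ k) := by
  have hSm := hS.measurable
  have hprob : ∀ k (lam : ProbabilityMeasure X),
      IsProbabilityMeasure (dualOp P S η X k (lam : Measure X)) :=
    isProbabilityMeasure_dualOp hSm hη hXm hηK hinv
  have hdual := fun k (lam : ProbabilityMeasure X) g (hg : IsUnitValued g) =>
    integral_dualOp hS hη hind hid hXm hηK hinv k lam hg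
  have hℓ := Measure.isProbabilityMeasure_map (μ := P) (hη 0).aemeasurable
  refine ⟨?_, fun ν hν => ?_, ?_⟩
  · let μ' : ProbabilityMeasure X := ⟨dualOp P S η X 1 (μ : Measure X), hprob 1 μ⟩
    suffices h : μ' = μ from congrArg (fun ρ : ProbabilityMeasure X => (ρ : Measure X)) h
    refine eq_of_forall_observable hXm (L₀ := L₀) fun L hL g hg => ?_
    change ∫ u, g (u : H) ∂(dualOp P S η X 1 (μ : Measure X)) = _
    rw [hdual 1 μ g hg.toIsUnitValued, Function.iterate_one]
    refine eq_of_forall_dist_le fun a ha => ?_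
    -- `P^N (P g)` and `P^(N+1) g` coincide, so one and the same integral is within `a/2` of both `∫
    -- P g dμ` and `∫ g dμ`.
    obtain ⟨N, hN⟩ := hμ L hL (a / 2) (by positivity)
    have h1 := hN N le_rfl _ (hobs L hL g hg) μ
    have h2 := hN (N + 1) (by omega) g hg μ
    rw [hdual _ _ _ (hobs L hL g hg).toIsUnitValued] at h1
    rw [hdual _ _ _ hg.toIsUnitValued, Function.iterate_succ_apply, abs_sub_comm] at h2
    rw [Real.dist_eq]
    rw [abs_sub_comm] at h1 h2
    have h3 := abs_sub_le (∫ u, markov (P.map (η 0)) S g (u : H) ∂(μ : Measure X))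
      (∫ u, (markov (P.map (η 0)) S)^[N] (markov (P.map (η 0)) S g) (u : H) ∂(μ : Measure X))
      (∫ u, g (u : H) ∂(μ : Measure X))
    linarith
  · refine eq_of_forall_observable hXm (L₀ := L₀) fun L hL g hg => ?_
    have hinvar : ∀ k, ∀ f, IsUnitValued f →
        ∫ u, (markov (P.map (η 0)) S)^[k] f (u : H) ∂(ν : Measure X) =
          ∫ u, f (u : H) ∂(ν : Measure X) := by
      intro k
      induction k with
      | zero => exact fun f _ => rfl
      | succ k ih =>
        intro f hf
        have h1 := hdual 1 ν f hf
        rw [hν, Function.iterate_one] at h1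
        rw [Function.iterate_succ_apply, ih _ (hf.markov hSm), h1]
    refine eq_of_forall_dist_le fun a ha => ?_
    obtain ⟨N, hN⟩ := hμ L hL a ha
    have h1 := hN N le_rfl g hg ν
    rwa [hdual _ _ _ hg.toIsUnitValued, hinvar N g hg.toIsUnitValued] at h1
  · let A : ℕ → ℝ≥0∞ := fun k => ⨆ lam : ProbabilityMeasure X,
      dualLip (dualOp P S η X k (lam : Measure X)) (μ : Measure X)
    -- The crude bound `2` makes the supremum finite, so that passing to real numbers by `toReal`
    -- loses nothing.
    have hA2 : ∀ k, A k ≤ ENNReal.ofReal (2 * 1) := fun k => iSup_le fun lam => by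
      refine dualLip_le_of_forall_observable hXm (L := 1) le_rfl fun g hg => ?_
      have h1 := hg.toIsUnitValued.integral_mem_Icc (μ := dualOp P S η X k (lam : Measure X))
        measurable_subtype_coe
      have h2 := hg.toIsUnitValued.integral_mem_Icc (μ := (μ : Measure X)) measurable_subtype_coe
      rw [abs_le]
      constructor <;> linarith [h1.1, h1.2, h2.1, h2.2]
    have hAt : ∀ k, A k ≠ ∞ := fun k => ((hA2 k).trans_lt ENNReal.ofReal_lt_top).ne
    have hlim : Tendsto (fun k => (A k).toReal) atTop (𝓝 0) := by
      refine Metric.tendsto_atTop.2 fun ε hε => ?_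
      obtain ⟨N, hN⟩ := hμ L₀ le_rfl (ε / 4) (by positivity)
      refine ⟨N, fun k hk => ?_⟩
      have : A k ≤ ENNReal.ofReal (2 * (ε / 4)) := iSup_le fun lam =>
        dualLip_le_of_forall_observable hXm hL₀ fun g hg => hN k hk g hg lam
      rw [Real.dist_eq, sub_zero, abs_of_nonneg ENNReal.toReal_nonneg]
      have := ENNReal.toReal_le_of_le_ofReal (by positivity) this
      linarith
    -- The summand `1 / (k + 1)` only serves to make the rate strictly positive.
    refine ⟨fun k => (A k).toReal + 1 / ((k : ℝ) + 1), fun k => by positivity, ?_, fun k lam => ?_⟩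
    · simpa using hlim.add tendsto_one_div_add_atTop_nhds_zero_nat
    · refine (le_iSup (fun lam : ProbabilityMeasure X =>
        dualLip (dualOp P S η X k (lam : Measure X)) (μ : Measure X)) lam).trans ?_
      change A k ≤ _
      rw [← ENNReal.ofReal_toReal (hAt k)]
      refine ENNReal.ofReal_le_ofReal ?_
      exact le_add_of_nonneg_right (by positivity)

end Stationary

end MixingRDS

theorem theorem1p1
    {H E V Ω : Type*}
    [NormedAddCommGroup H] [InnerProductSpace ℝ H] [CompleteSpace H]
    [TopologicalSpace.SeparableSpace H] [MeasurableSpace H] [BorelSpace H]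
    [NormedAddCommGroup E] [InnerProductSpace ℝ E] [CompleteSpace E]
    [TopologicalSpace.SeparableSpace E] [MeasurableSpace E] [BorelSpace E]
    [NormedAddCommGroup V] [InnerProductSpace ℝ V] [CompleteSpace V]
    [MeasurableSpace Ω] (P : Measure Ω) [IsProbabilityMeasure P]
    (S : H × E → H) (hS : Continuous S)
    (η : ℕ → Ω → E) (hη_meas : ∀ k, Measurable (η k))
    (hη_indep : iIndepFun η P) (hη_ident : ∀ k, IdentDistrib (η k) (η 0) P P)
    (hK : IsCompact (P.map (η 0)).support)
    (X : Set H) (hX : IsCompact X)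
    (hX_inv : ∀ u ∈ X, ∀ ζ ∈ (P.map (η 0)).support, S (u, ζ) ∈ X)
    (emb : V →L[ℝ] H) (hemb_inj : Function.Injective emb) (hemb_compact : IsCompactOperator emb)
    (h1 : MixingRDS.Regular emb S)
    (h2 : MixingRDS.ControllableToPoint S X (P.map (η 0)).support)
    (h3 : MixingRDS.LinControllable S X (P.map (η 0)))
    (h4 : MixingRDS.Decomposable P η) :
    ∃ μ : ProbabilityMeasure X,
      MixingRDS.IsStationary P S η X μ ∧
      (∀ ν : ProbabilityMeasure X, MixingRDS.IsStationary P S η X ν → ν = μ) ∧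
      ∃ γ : ℕ → ℝ, (∀ k, 0 < γ k) ∧ Tendsto γ atTop (𝓝 0) ∧
        ∀ (k : ℕ) (lam : ProbabilityMeasure X),
          MixingRDS.dualLip (MixingRDS.dualOp P S η X k (lam : Measure X)) (μ : Measure X)
            ≤ ENNReal.ofReal (γ k) := by
  have : SecondCountableTopology H := UniformSpace.secondCountable_of_separable H
  have : SecondCountableTopology E := UniformSpace.secondCountable_of_separable E
  have hℓ := Measure.isProbabilityMeasure_map (μ := P) (hη_meas 0).aemeasurable
  have hKae : ∀ᵐ z ∂(P.map (η 0)), z ∈ (P.map (η 0)).support := Measure.support_mem_ae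
  have hηK : ∀ᵐ ω ∂P, ∀ i, η i ω ∈ (P.map (η 0)).support := by
    refine ae_all_iff.2 fun i => ae_of_ae_map (hη_meas i).aemeasurable ?_
    rw [(hη_ident i).map_eq]
    exact hKae
  obtain ⟨R, hR⟩ := hK.isBounded.exists_norm_le
  obtain ⟨J, e, he⟩ := h4.exists_basis (hη_meas 0) (abs_nonneg R)
    (hηK.mono fun ω hω => (hR _ (hω 0)).trans (le_abs_self R))
  have hSc : Continuous fun x => fderiv ℝ S x ∘L ContinuousLinearMap.inl ℝ H E :=
    (h1.contDiff.continuous_fderiv (by norm_num)).clm_comp continuous_const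
  obtain ⟨B, hB⟩ := (hX.prod hK).exists_bound_of_continuousOn hSc.continuousOn
  have hΛ0 : 0 < max B 1 := lt_max_of_lt_right one_pos
  -- The exceptional set of noises gets measure `σ` with `σ Λ = 1/4`; taking `Λ = max B 1` ensures
  -- `Λ > 0` and `q ≤ Λ`.
  obtain ⟨C, hC, hF⟩ := h1.exists_squeezing hemb_compact hX hK h3 e he (q := 1 / 4)
    (σ := 1 / (4 * max B 1)) (Λ := max B 1) (by norm_num) (by positivity)
    (le_trans (by norm_num) (le_max_right B 1))
    fun u hu z hz => (hB (u, z) ⟨hu, hz⟩).trans (le_max_left _ _)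
  -- The threshold `8 C + 1` gives both `L ≥ 8 C`, for the invariance of the class, and `L ≥ 1`, for
  -- the dual-Lipschitz distance.
  have hobs : ∀ L, 8 * C + 1 ≤ L → ∀ g, MixingRDS.IsObservable X L g →
      MixingRDS.IsObservable X L (MixingRDS.markov (P.map (η 0)) S g) := fun L hL g hg =>
    hg.markov hS hK.isClosed hKae hX_inv hΛ0.le hC (by field_simp; norm_num) hF (by linarith)
  obtain ⟨p, hp, hreach⟩ := h2
  have : Nonempty X := ⟨⟨p, hp⟩⟩
  have hosc : ∀ L, 8 * C + 1 ≤ L → ∀ a : ℝ, 0 < a → ∃ N : ℕ, ∀ k, N ≤ k →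
      ∀ g, MixingRDS.IsObservable X L g →
      MixingRDS.OscLE X ((MixingRDS.markov (P.map (η 0)) S)^[k] g) a := fun L hL a ha => by
    refine MixingRDS.exists_oscLE_iterate hS hη_meas hη_indep hη_ident hηK hX_inv
      (by linarith) (hobs L hL) hp (fun ε hε => ?_) ha
    obtain ⟨m, hm, h⟩ := hreach ε hε
    exact ⟨m, MixingRDS.exists_reach_probability hS hη_meas hη_indep hη_ident hX hm h⟩
  obtain ⟨μ, hμ⟩ := MixingRDS.exists_mixing_measure hS hη_meas hη_indep hη_ident hX hηK hX_inv
    (by linarith) hosc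
  exact ⟨μ, MixingRDS.stationary_of_mixing hS hη_meas hη_indep hη_ident hX.measurableSet hηK
    hX_inv (by linarith) hobs hμ⟩
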